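/- Let $G$ be a connected complex semisimple algebraic group with Lie algebra $\mathfrak g$, and identify $G$ and its subgroups with their diagonal copies in $D=G\times G$, whose Lie algebra is $\mathfrak d=\mathfrak g\times\mathfrak g$. Let $\mathfrak h$ be a Cartan subalgebra of $\mathfrak g$, $\mathbf R$ the root system, $\alpha_1,\dots,\alpha_n$ a basis of $\mathbf R$, $\mathbf R_+$ the set of positive roots, $h_1,\dots,h_n\in\mathfrak h$ the simple coroots, $a_{ij}=\alpha_j(h_i)$ the Cartan matrix, $\mathfrak n^{\pm}=\bigoplus_{\alpha\in\mathbf R_+}\mathfrak g_{\pm\alpha}$, and $\mathbf P\subset\mathfrak h^*$ the lattice of weights. Let $(-,-)$ be a nondegenerate invariant symmetric bilinear form on $\mathfrak g$ such that the induced form on $\mathfrak h^*$ satisfies $(\alpha_i,\alpha_j)=d_ia_{ij}$ for positive integers $d_i$. Let $u=\sum_{i,j}u_{ij}\,h_i\otimes h_j\in\wedge^2\mathfrak h$, with $[u_{ij}]$ a skew-symmetric complex matrix. Regard $u$ as the alternating form $u(\lambda,\mu)=\sum_{i,j}u_{ij}\lambda(h_i)\mu(h_j)$ on $\mathfrak h^*$,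 and also as the endomorphism $u(x)=\sum_{i,j}u_{ij}(x,h_i)h_j$ of $\mathfrak h$; let $\Phi=-{}^tu\in\operatorname{End}\mathfrak h^*$ be the negative of the transpose of this endomorphism. Put $$\mathfrak a=\{(-(u(x)-x),\,-(u(x)+x)) : x\in\mathfrak h\},\qquad \mathfrak g_r=\mathfrak a\oplus(\mathfrak n^+\times\mathfrak n^-)\subset\mathfrak d ,$$ the dual Lie algebra attached to $r=\sum_{\alpha\in\mathbf R_+}e_\alpha\wedge e_{-\alpha}-u$, where the $e_\alpha$ are root vectors with $(e_\alpha,e_\beta)=\delta_{\alpha,-\beta}$. Let $A$ and $G_r$ be the connected analytic subgroups of $D$ with Lie algebras $\mathfrak a$ and $\mathfrak g_r$, let $H$ be the connected subgroup of $G$ with Lie algebra $\mathfrak h$, and let $\Gamma=A\cap H$. Then $\Gamma=G\cap G_r$, and the following are equivalent: (i) $\mathfrak g_r$ is an algebraic Lie subalgebra of $\mathfrak d$, that is, the Lie algebra of a closed algebraic subgroup of $D$; (ii) $u(\mathbf P\times\mathbf P)\subset\mathbb Q$; (iii) there is an integer $m\ge 1$ with $\Phi(m\mathbf P)\subset\mathbf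 P$; (iv) $\Gamma$ is finite. -/

import Mathlib

open Module TensorProduct

-- The commutator bracket on matrices.
attribute [local instance] LieRing.ofAssociativeRing

noncomputable section

set_option linter.unusedSectionVars false

namespace MultiParam

/-! ### The Lie algebra side -/

section LieSide

variable {L : Type*} [LieRing L] [LieAlgebra ℂ L] [FiniteDimensional ℂ L]
  [LieAlgebra.HasTrivialRadical ℂ L]
  (H : LieSubalgebra ℂ L) [H.IsCartanSubalgebra]

/-- The root system of a semisimple complex Lie algebra with respect to a Cartan subalgebra; its
roots live in the dual of `H`, its coroots in `H`. -/
abbrev roots : RootPairing H.root ℂ (Dual ℂ H) H := LieAlgebra.IsKilling.rootSystem H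

/-- The lattice of weights: the `lam` in `H*` which take integral values on all coroots. -/
def weightLattice : AddSubgroup (Dual ℂ H) where
  carrier := {lam | ∀ i : H.root, ∃ z : ℤ, lam ((roots H).coroot i) = z}
  zero_mem' := fun _ => ⟨0, by simp⟩
  add_mem' := by
    intro a b ha hb i
    obtain ⟨x, hx⟩ := ha i
    obtain ⟨y, hy⟩ := hb i
    exact ⟨x + y, by rw [LinearMap.add_apply, hx, hy, Int.cast_add]⟩
  neg_mem' := by
    intro a ha i
    obtain ⟨x, hx⟩ := ha i
    exact ⟨-x, by rw [LinearMap.neg_apply, hx, Int.cast_neg]⟩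

variable {H}

/-- `B` is a nondegenerate invariant symmetric bilinear form on `L` such that the form which it
induces on the dual of `H` satisfies `(α i, α j) = d i * a i j` for the simple roots `α i`, where
`a i j = α j (h i)` is the Cartan matrix, `h i` being the coroot of `α i`, and the `d i` are
positive integers. Here `t i` is the element of `H` that `B` identifies with `α i`. -/
structure IsNormalizedForm (b : (roots H).Base) (d : b.support → ℕ)
    (B : LinearMap.BilinForm ℂ L) : Prop where
  symm : B.IsSymm
  nondegenerate : B.Nondegenerate
  invariant : ∀ x y z : L, B ⁅x, y⁆ z = B x ⁅y, z⁆
  pos : ∀ i, 0 < d i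
  normalized : ∃ t : b.support → H,
    (∀ i, ∀ x : H, B (t i) x = (roots H).root i x) ∧
    ∀ i j, B (t i) (t j) = d i * (roots H).root j ((roots H).coroot i)

/-- The bilinear form on `H*` given by a tensor `u ∈ H ⊗ H`: if `u = ∑ u i j • h i ⊗ h j` then
`u(lam, mu) = ∑ u i j * lam (h i) * mu (h j)`. -/
def formOf (u : H ⊗[ℂ] H) (lam mu : Dual ℂ H) : ℂ :=
  TensorProduct.dualDistrib ℂ H H (lam ⊗ₜ[ℂ] mu) u

/-- The linear map `H → H*` sending `h` to `x ↦ B x h`. -/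
def pairingMap (B : LinearMap.BilinForm ℂ L) : H →ₗ[ℂ] Dual ℂ H :=
  B.flip.compl₁₂ H.toSubmodule.subtype H.toSubmodule.subtype

/-- The endomorphism of `H` given by `u ∈ H ⊗ H` and a form `B` on `L`: if
`u = ∑ u i j • h i ⊗ h j` then `u(x) = ∑ (u i j * B x (h i)) • h j`. -/
def endOf (B : LinearMap.BilinForm ℂ L) (u : H ⊗[ℂ] H) : H →ₗ[ℂ] H :=
  dualTensorHom ℂ H H ((pairingMap B).rTensor H u)

/-- `Φ`, the negative of the transpose of the endomorphism `u` of `H`. -/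
def Phi (B : LinearMap.BilinForm ℂ L) (u : H ⊗[ℂ] H) : Dual ℂ H →ₗ[ℂ] Dual ℂ H :=
  -(endOf B u).dualMap

theorem endOf_tmul (B : LinearMap.BilinForm ℂ L) (h k x : H) :
    endOf B (h ⊗ₜ[ℂ] k) x = B x h • k := by
  simp only [endOf, LinearMap.rTensor_tmul, dualTensorHom_apply]
  rfl

theorem formOf_tmul (h k : H) (lam mu : Dual ℂ H) :
    formOf (h ⊗ₜ[ℂ] k) lam mu = lam h * mu k := by
  simp [formOf]

/-- The sum of the root spaces of the roots with index in `S`. -/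
def rootSum (S : Set H.root) : Submodule ℂ L :=
  ⨆ i ∈ S, (LieAlgebra.rootSpace H ((roots H).root i)).toSubmodule

/-- `n⁺`, the sum of the positive root spaces. -/
def nPos (b : (roots H).Base) : Submodule ℂ L := rootSum {i | b.IsPos i}

/-- `n⁻`, the sum of the negative root spaces. -/
def nNeg (b : (roots H).Base) : Submodule ℂ L := rootSum {i | ¬ b.IsPos i}

theorem lie_mem_rootSum {S : Set H.root}
    (h0 : ∀ i ∈ S, ∀ j ∈ S, (roots H).root i + (roots H).root j ≠ 0)
    (hadd : ∀ i ∈ S, ∀ j ∈ S, ∀ k, (roots H).root k = (roots H).root i + (roots H).root j → k ∈ S)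
    {x y : L} (hx : x ∈ rootSum S) (hy : y ∈ rootSum S) : ⁅x, y⁆ ∈ rootSum S := by
  rw [rootSum] at hx hy
  induction hx using Submodule.iSup_induction' with
  | zero => simp
  | add a c _ _ ha hc => rw [add_lie]; exact add_mem ha hc
  | mem i x hx =>
    by_cases hi : i ∈ S
    swap
    · simp [hi] at hx; simp [hx]
    simp only [hi, iSup_pos] at hx
    induction hy using Submodule.iSup_induction' with
    | zero => simp
    | add a c _ _ ha hc => rw [lie_add]; exact add_mem ha hc
    | mem j y hy =>
      by_cases hj : j ∈ S
      swap
      · simp [hj] at hy; simp [hy]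
      simp only [hj, iSup_pos] at hy
      have hxy := LieAlgebra.lie_mem_genWeightSpace_of_mem_genWeightSpace hx hy
      by_cases hb : LieAlgebra.rootSpace H
          (((roots H).root i : H → ℂ) + ((roots H).root j : H → ℂ)) = ⊥
      · have h1 : ⁅x, y⁆ = 0 := by
          have h2 : ⁅x, y⁆ ∈ LieAlgebra.rootSpace H
            (((roots H).root i : H → ℂ) + ((roots H).root j : H → ℂ)) := hxy
          rw [hb] at h2
          simpa using h2
        rw [h1]; exact zero_mem _
      · let w : LieModule.Weight ℂ H L := ⟨_, hb⟩
        have hw : w ∈ H.root := by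
          simp only [LieSubalgebra.root, Finset.mem_filter, Finset.mem_univ, true_and]
          intro hz
          apply h0 i hi j hj
          ext z
          exact congrFun hz z
        have hk : (⟨w, hw⟩ : H.root) ∈ S := hadd i hi j hj _ (by ext z; rfl)
        exact Submodule.mem_iSup_of_mem ⟨w, hw⟩ (Submodule.mem_iSup_of_mem hk hxy)

theorem lie_mem_rootSum_of_cartan {S : Set H.root} (h : H) {x : L} (hx : x ∈ rootSum S) :
    ⁅(h : L), x⁆ ∈ rootSum S := by
  rw [rootSum] at hx
  induction hx using Submodule.iSup_induction' with
  | zero => simp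
  | add a c _ _ ha hc => rw [lie_add]; exact add_mem ha hc
  | mem i x hx =>
    by_cases hi : i ∈ S
    swap
    · simp [hi] at hx; simp [hx]
    simp only [hi, iSup_pos] at hx
    have := (LieAlgebra.rootSpace H ((roots H).root i)).lie_mem (x := h) hx
    exact Submodule.mem_iSup_of_mem i (Submodule.mem_iSup_of_mem hi this)

theorem root_add_ne_zero (b : (roots H).Base) {i j : H.root}
    (hij : b.IsPos i ↔ b.IsPos j) : (roots H).root i + (roots H).root j ≠ 0 := by
  intro h
  have h1 : (roots H).root j = (roots H).root i + (-2 : ℤ) • (roots H).root i := by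
    have h2 : (roots H).root j = -(roots H).root i := (neg_eq_of_add_eq_zero_right h).symm
    rw [h2]; module
  have h3 := b.height_add_zsmul h1
  have h4 := b.height_ne_zero i
  simp only [RootPairing.Base.isPos_iff] at hij
  simp only [smul_eq_mul] at h3
  omega

theorem lie_mem_nPos (b : (roots H).Base) {x y : L} (hx : x ∈ nPos b) (hy : y ∈ nPos b) :
    ⁅x, y⁆ ∈ nPos b :=
  lie_mem_rootSum (fun _ hi _ hj => root_add_ne_zero b (iff_of_true hi hj))
    (fun _ hi _ hj _ hk => RootPairing.Base.IsPos.add hi hj hk) hx hy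

theorem lie_mem_nNeg (b : (roots H).Base) {x y : L} (hx : x ∈ nNeg b) (hy : y ∈ nNeg b) :
    ⁅x, y⁆ ∈ nNeg b := by
  refine lie_mem_rootSum (fun _ hi _ hj => root_add_ne_zero b (iff_of_false hi hj))
    (fun i hi j hj k hk => ?_) hx hy
  have h1 : ¬ 0 < b.height i := hi
  have h2 : ¬ 0 < b.height j := hj
  have h3 := b.height_add hk
  have h4 : ¬ 0 < b.height k := by omega
  exact h4

/-- The map `ϑ : H → L × L`, `x ↦ -(u₋ x, u₊ x)`, where `u₊ = u + 1` and `u₋ = u - 1`. -/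
def theta (B : LinearMap.BilinForm ℂ L) (u : H ⊗[ℂ] H) : H →ₗ[ℂ] L × L :=
  -((H.toSubmodule.subtype ∘ₗ (endOf B u - LinearMap.id)).prod
    (H.toSubmodule.subtype ∘ₗ (endOf B u + LinearMap.id)))

theorem theta_apply (B : LinearMap.BilinForm ℂ L) (u : H ⊗[ℂ] H) (x : H) :
    theta B u x = (-((endOf B u x - x : H) : L), -((endOf B u x + x : H) : L)) := rfl

theorem lie_theta_theta (B : LinearMap.BilinForm ℂ L) (u : H ⊗[ℂ] H) (x y : H) :
    ⁅theta B u x, theta B u y⁆ = 0 := by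
  have key : ∀ h k : H, ⁅(h : L), (k : L)⁆ = 0 := fun h k => by
    rw [← LieSubalgebra.coe_bracket, LieModule.IsTrivial.trivial, ZeroMemClass.coe_zero]
  simp only [theta_apply, LieAlgebra.Prod.bracket_apply, neg_lie, lie_neg, key, neg_zero]
  rfl

/-- The abelian Lie subalgebra `𝔞 = ϑ(H)` of `L × L`. -/
def aLie (B : LinearMap.BilinForm ℂ L) (u : H ⊗[ℂ] H) : LieSubalgebra ℂ (L × L) where
  toSubmodule := LinearMap.range (theta B u)
  lie_mem' := by
    rintro _ _ ⟨x, rfl⟩ ⟨y, rfl⟩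
    rw [lie_theta_theta]
    exact zero_mem (LinearMap.range (theta B u))

/-- The Lie subalgebra `𝔤_r = 𝔞 ⊕ (n⁺ × n⁻)` of `L × L`. -/
def gr (b : (roots H).Base) (B : LinearMap.BilinForm ℂ L) (u : H ⊗[ℂ] H) :
    LieSubalgebra ℂ (L × L) where
  toSubmodule := LinearMap.range (theta B u) ⊔ (nPos b).prod (nNeg b)
  lie_mem' := by
    have key : ∀ x : H, ∀ n ∈ (nPos b).prod (nNeg b),
        ⁅theta B u x, n⁆ ∈ (nPos b).prod (nNeg b) := by
      rintro x ⟨n, m⟩ ⟨hn, hm⟩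
      rw [theta_apply]
      refine ⟨?_, ?_⟩
      · exact lie_mem_rootSum_of_cartan (-(endOf B u x - x)) hn
      · exact lie_mem_rootSum_of_cartan (-(endOf B u x + x)) hm
    intro p q hp hq
    obtain ⟨_, ⟨x, rfl⟩, n, hn, rfl⟩ := Submodule.mem_sup.1 hp
    obtain ⟨_, ⟨y, rfl⟩, m, hm, rfl⟩ := Submodule.mem_sup.1 hq
    refine Submodule.mem_sup_right (T := (nPos b).prod (nNeg b)) ?_
    rw [add_lie, lie_add, lie_add, lie_theta_theta, zero_add]
    refine add_mem (key x m hm) (add_mem ?_ ⟨lie_mem_nPos b hn.1 hm.1, lie_mem_nNeg b hn.2 hm.2⟩)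
    rw [← lie_skew]
    exact neg_mem (key y n hn)

/-- The diagonal copy in `L × L` of a Lie subalgebra of `L`. -/
def diagLie (K : LieSubalgebra ℂ L) : LieSubalgebra ℂ (L × L) :=
  K.map (LieHom.prod LieHom.id LieHom.id)

end LieSide

/-! ### The group side: linear algebraic groups as Zariski closed subgroups of `GL_N(ℂ)` -/

/-- A subset `S` of `X` is Zariski closed with respect to coordinate functions `coord` on `X` if
it is the set of common zeros in `X` of some set of polynomials in the coordinates. -/
def IsZariskiClosed {X σ : Type*} (coord : X → σ → ℂ) (S : Set X) : Prop :=
  ∃ I : Set (MvPolynomial σ ℂ), S = {x | ∀ p ∈ I, MvPolynomial.eval (coord x) p = 0}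

section GroupSide

variable {N : ℕ}

/-- The matrix entries, as coordinates on `GL_N(ℂ)`. -/
def glCoord (g : GL (Fin N) ℂ) : Fin N × Fin N → ℂ :=
  fun ij => (g : Matrix (Fin N) (Fin N) ℂ) ij.1 ij.2

/-- The entries of both matrices, as coordinates on `GL_N(ℂ) × GL_N(ℂ)`. -/
def glProdCoord (p : GL (Fin N) ℂ × GL (Fin N) ℂ) :
    (Fin N × Fin N) ⊕ (Fin N × Fin N) → ℂ :=
  Sum.elim (glCoord p.1) (glCoord p.2)

/-- The exponential of a matrix as an element of `GL_N(ℂ)`. -/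
def expGL (X : Matrix (Fin N) (Fin N) ℂ) : GL (Fin N) ℂ := (Matrix.isUnit_exp X).unit

theorem coe_expGL (X : Matrix (Fin N) (Fin N) ℂ) :
    (expGL X : Matrix (Fin N) (Fin N) ℂ) = NormedSpace.exp X := rfl

/-- `g` is the Lie algebra of the subgroup `G` of `GL_N(ℂ)`: it consists of the matrices that
generate one-parameter subgroups of `G`. -/
def IsLieAlgebraOf (g : LieSubalgebra ℂ (Matrix (Fin N) (Fin N) ℂ))
    (G : Subgroup (GL (Fin N) ℂ)) : Prop :=
  ∀ X : Matrix (Fin N) (Fin N) ℂ, X ∈ g ↔ ∀ t : ℂ, expGL (t • X) ∈ G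

variable {g : LieSubalgebra ℂ (Matrix (Fin N) (Fin N) ℂ)}

/-- The exponential map of `g × g`. -/
def expProd (X : g × g) : GL (Fin N) ℂ × GL (Fin N) ℂ :=
  (expGL (X.1 : Matrix (Fin N) (Fin N) ℂ), expGL (X.2 : Matrix (Fin N) (Fin N) ℂ))

/-- The connected analytic subgroup with Lie algebra `m`, that is, the subgroup generated by the
exponentials of the elements of `m`. -/
def analyticSubgroup (m : LieSubalgebra ℂ (g × g)) : Subgroup (GL (Fin N) ℂ × GL (Fin N) ℂ) :=
  Subgroup.closure (expProd '' (m : Set (g × g)))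

/-- The Lie subalgebra `m` of `g × g` is algebraic if it is the Lie algebra of a Zariski closed
subgroup `K` of `G × G`, where `G` is a group with Lie algebra `g`. -/
def IsAlgebraicLie (G : Subgroup (GL (Fin N) ℂ)) (m : LieSubalgebra ℂ (g × g)) : Prop :=
  ∃ K : Subgroup (GL (Fin N) ℂ × GL (Fin N) ℂ), K ≤ G.prod G ∧
    IsZariskiClosed glProdCoord (K : Set (GL (Fin N) ℂ × GL (Fin N) ℂ)) ∧
    ∀ X : g × g, X ∈ m ↔ ∀ t : ℂ, expProd (t • X) ∈ K

/-- The diagonal copy in `GL_N(ℂ) × GL_N(ℂ)` of a subgroup of `GL_N(ℂ)`. -/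
def diagSubgroup (G : Subgroup (GL (Fin N) ℂ)) : Subgroup (GL (Fin N) ℂ × GL (Fin N) ℂ) :=
  G.map (MonoidHom.prod (MonoidHom.id _) (MonoidHom.id _))

/-- `Γ = A ∩ H` inside `G × G`, where `A` is the connected analytic subgroup with Lie algebra `𝔞`
and `H`, the connected analytic subgroup with Lie algebra `h`, is embedded diagonally. -/
def Gam [LieAlgebra.HasTrivialRadical ℂ g] {h : LieSubalgebra ℂ g} [h.IsCartanSubalgebra]
    (B : LinearMap.BilinForm ℂ g) (u : h ⊗[ℂ] h) : Subgroup (GL (Fin N) ℂ × GL (Fin N) ℂ) :=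
  analyticSubgroup (aLie B u) ⊓ analyticSubgroup (diagLie h)

end GroupSide

end MultiParam

end

/-! Everything is compared with one condition, `IsRatTensor`: the endomorphism `u` maps each simple
coroot to a rational combination of simple coroots.

The setting is made concrete by a weight basis of `ℂ^N` (`exists_weightFrame`). Each coroot lies in
an `sl₂`-triple, so it acts diagonalisably with integral eigenvalues; hence the Cartan subalgebra
becomes diagonal with integral weights `λ_k`, which separate its points. Ordering the basis by the
values of the weights at an element where every root takes its height makes `n⁺` strictly upper and
`n⁻` strictly lower triangular.

Elements of `G_r` are then pairs of an upper and a lower triangular matrix, whose diagonals are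
those of `(exp(x - ux), exp(-(ux + x)))` for some `x` in the Cartan subalgebra. If the two
components agree, the common matrix is both upper and lower triangular, so it is diagonal; this
gives `Γ = G ∩ G_r` (`Gam_eq`). Equality of the components means `exp(2x) = 1`.

Conditions (ii) and (iii) are `IsRatTensor` in other words: the normalisation of the form gives `d_i
μ(u h_i) = u(α_i, μ)`, and `m` in (iii) clears denominators. For (iv), `x = πi h_j` gives a point of
`Γ`, whose finite order forces the numbers `λ_k(u h_j)` to be rational; conversely, bounded
denominators make all diagonal entries of points of `Γ` roots of unity of bounded order.

For (i), a rational `u` makes `𝔞` the zero set of linear relations with integral coefficients in the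
weights, which exponentiate to monomial equations on the diagonal entries
(`IsRatTensor.isAlgebraicLie`). Conversely, an algebraic Lie algebra is closed under replicas: a
polynomial vanishing on `exp(tX)`, `X` diagonalisable, still vanishes when an additive map is
applied to the eigenvalues. A `ℚ`-linear projection `ℂ → ℚ` replaces `u h_i` by a rational vector,
and membership in `𝔤_r` forces the two to be equal (`IsRatTensor.of_isAlgebraicLie`). -/

noncomputable section

set_option linter.unusedSectionVars false

namespace MultiParam

/-! ### Diagonalisability and integrality for `sl₂`-triples, by the Casimir element. -/

section Sl2

open LieModule

variable {L V : Type*} [LieRing L] [LieAlgebra ℂ L] [AddCommGroup V] [Module ℂ V]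
  [LieRingModule L V] [LieModule ℂ L V] {h e f : L}

/-- The action of the Casimir element of an `sl₂`-triple on a representation. -/
def casimir (V : Type*) [AddCommGroup V] [Module ℂ V] [LieRingModule L V] [LieModule ℂ L V]
    (h e f : L) : End ℂ V :=
  (4 : ℂ) • (toEnd ℂ L V f * toEnd ℂ L V e) + toEnd ℂ L V h * toEnd ℂ L V h
    + (2 : ℂ) • toEnd ℂ L V h

theorem casimir_apply (v : V) :
    casimir V h e f v = (4 : ℂ) • ⁅f, ⁅e, v⁆⁆ + ⁅h, ⁅h, v⁆⁆ + (2 : ℂ) • ⁅h, v⁆ := rfl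

theorem lie_h_lie_e (t : IsSl2Triple h e f) (v : V) :
    ⁅h, ⁅e, v⁆⁆ = ⁅e, ⁅h, v⁆⁆ + (2 : ℂ) • ⁅e, v⁆ := by
  rw [leibniz_lie h, t.lie_h_e_smul ℂ, smul_lie, add_comm]

theorem lie_h_lie_f (t : IsSl2Triple h e f) (v : V) :
    ⁅h, ⁅f, v⁆⁆ = ⁅f, ⁅h, v⁆⁆ - (2 : ℂ) • ⁅f, v⁆ := by
  rw [leibniz_lie h, t.lie_lie_smul_f ℂ, neg_lie, smul_lie]; abel

theorem lie_e_lie_f (t : IsSl2Triple h e f) (v : V) : ⁅e, ⁅f, v⁆⁆ = ⁅f, ⁅e, v⁆⁆ + ⁅h, v⁆ := by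
  rw [leibniz_lie e, t.lie_e_f, add_comm]

theorem casimir_symm (t : IsSl2Triple h e f) : casimir V (-h) f e = casimir V h e f := by
  ext v
  simp only [casimir_apply, neg_lie, lie_neg, lie_e_lie_f t]
  module

theorem commute_casimir_h (t : IsSl2Triple h e f) : Commute (casimir V h e f) (toEnd ℂ L V h) := by
  ext v
  simp only [Module.End.mul_apply, casimir_apply, toEnd_apply_apply, lie_add, lie_smul,
    lie_h_lie_e t, lie_h_lie_f t, smul_add, smul_sub]
  module

theorem commute_casimir_e (t : IsSl2Triple h e f) : Commute (casimir V h e f) (toEnd ℂ L V e) := by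
  ext v
  simp only [Module.End.mul_apply, casimir_apply, toEnd_apply_apply, lie_add, lie_smul,
    lie_h_lie_e t, lie_e_lie_f t, smul_add]
  module

theorem commute_casimir_f (t : IsSl2Triple h e f) : Commute (casimir V h e f) (toEnd ℂ L V f) := by
  have := commute_casimir_e (V := V) t.symm
  rwa [casimir_symm t] at this

theorem toEnd_pow_mem {A B : End ℂ V} (hAB : Commute A B) {c : ℂ} {v : V}
    (hv : v ∈ A.maxGenEigenspace c) (n : ℕ) : (B ^ n) v ∈ A.maxGenEigenspace c :=
  Module.End.mapsTo_maxGenEigenspace_of_comm (hAB.pow_right n) c hv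

/-- Applying `e` raises the eigenvalue of `h` by 2, and there are only finitely many eigenvalues, so
the process ends at a primitive vector. -/
theorem exists_primitive_of_eigenvector [FiniteDimensional ℂ V] (t : IsSl2Triple h e f) {w : V}
    {a : ℂ} (hw0 : w ≠ 0) (hw : ⁅h, w⁆ = a • w) :
    ∃ i m : ℕ, t.HasPrimitiveVectorWith ((toEnd ℂ L V e ^ i) w) (m : ℂ) ∧ a + 2 * i = m := by
  have hzero : ∃ k, (toEnd ℂ L V e ^ k) w = 0 := by
    by_contra! contra
    have hinj : Function.Injective fun n : ℕ => a + 2 * (n : ℂ) := fun p q hpq => by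
      simpa using hpq
    refine (Set.infinite_range_of_injective hinj).mono ?_ (toEnd ℂ L V h).finite_hasEigenvalue
    rintro _ ⟨n, rfl⟩
    refine Module.End.hasEigenvalue_of_hasEigenvector ⟨?_, contra n⟩
    rw [Module.End.mem_eigenspace_iff, toEnd_apply_apply]
    exact t.lie_h_pow_toEnd_e hw n
  obtain ⟨i, hi, hi'⟩ := Nat.exists_not_and_succ_of_not_zero_of_exists (p := fun k =>
    (toEnd ℂ L V e ^ k) w = 0) hw0 hzero
  have hp : t.HasPrimitiveVectorWith ((toEnd ℂ L V e ^ i) w) (a + 2 * i) :=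
    ⟨hi, t.lie_h_pow_toEnd_e hw i, by rwa [IsSl2Triple.lie_e_pow_toEnd_e i]⟩
  obtain ⟨m, hm⟩ := hp.exists_nat
  exact ⟨i, m, hm ▸ hp, hm⟩

theorem casimir_eigenvalue_of_primitive [FiniteDimensional ℂ V] {t : IsSl2Triple h e f} {w : V}
    {m : ℕ} {c : ℂ} (hp : t.HasPrimitiveVectorWith w (m : ℂ))
    (hw : w ∈ (casimir V h e f).maxGenEigenspace c) : c = m * (m + 2) := by
  by_contra hc
  refine hp.ne_zero ((Submodule.disjoint_def.1 (Module.End.disjoint_genEigenspace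
    (casimir V h e f) hc ⊤ 1)) w hw ?_)
  rw [Module.End.genEigenspace_one, LinearMap.mem_ker, LinearMap.sub_apply, casimir_apply, hp.lie_e,
    hp.lie_h, lie_smul, hp.lie_h]
  simp only [lie_zero, LinearMap.smul_apply, Module.End.one_apply]
  module

/-- The Casimir element acts on a primitive vector of weight `m` by `m(m + 2)`, and this determines
the natural number `m`. -/
theorem primitive_weight_unique [FiniteDimensional ℂ V] {t : IsSl2Triple h e f} {w : V}
    {m m' : ℕ} {c : ℂ} (hp : t.HasPrimitiveVectorWith w (m : ℂ))
    (hw : w ∈ (casimir V h e f).maxGenEigenspace c) (hc : c = m' * (m' + 2)) : m = m' := by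
  have h1 := casimir_eigenvalue_of_primitive hp hw
  rw [hc] at h1
  have h2 : m' * (m' + 2) = m * (m + 2) := by exact_mod_cast h1
  nlinarith

theorem lie_h_toEnd_f_pow_of_jordan (t : IsSl2Triple h e f) {v w : V} {a : ℂ}
    (hv : ⁅h, v⁆ = a • v + w) (j : ℕ) :
    ⁅h, (toEnd ℂ L V f ^ j) v⁆ =
      (a - 2 * j) • (toEnd ℂ L V f ^ j) v + (toEnd ℂ L V f ^ j) w := by
  induction j with
  | zero => simpa using hv
  | succ j ih =>
    simp only [pow_succ', Module.End.mul_apply, toEnd_apply_apply] at ih ⊢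
    rw [lie_h_lie_f t, ih, lie_add, lie_smul]
    push_cast
    module

theorem lie_e_toEnd_f_pow_of_jordan (t : IsSl2Triple h e f) {v w : V} {a : ℂ}
    (hv : ⁅h, v⁆ = a • v + w) (hev : ⁅e, v⁆ = 0) (j : ℕ) :
    ⁅e, (toEnd ℂ L V f ^ (j + 1)) v⁆ =
      ((j + 1) * (a - j)) • (toEnd ℂ L V f ^ j) v + (j + 1 : ℂ) • (toEnd ℂ L V f ^ j) w := by
  induction j with
  | zero => simp [lie_e_lie_f t, hev, hv]
  | succ j ih =>
    rw [pow_succ' _ (j + 1), Module.End.mul_apply, toEnd_apply_apply, lie_e_lie_f t, ih,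
      lie_h_toEnd_f_pow_of_jordan t hv]
    simp only [pow_succ', Module.End.mul_apply, toEnd_apply_apply, lie_add, lie_smul]
    push_cast
    module

/-- A nontrivial Jordan block of `h` is raised until `w` becomes primitive of weight `m`. There `e`
kills `v`, and `e f^(m+1) v = (m+1) f^m w ≠ 0`, so `f^(m+1) v` is a nonzero vector of weight `-m-2`.
For the opposite triple this produces a primitive vector of weight at least `m + 2` with the same
Casimir eigenvalue, which is impossible. -/
theorem eq_zero_of_jordan [FiniteDimensional ℂ V] (t : IsSl2Triple h e f) {v w : V} {a c : ℂ}
    (hvc : v ∈ (casimir V h e f).maxGenEigenspace c)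
    (hv : ⁅h, v⁆ = a • v + w) (hw : ⁅h, w⁆ = a • w) : w = 0 := by
  by_contra hw0
  have hwc : w ∈ (casimir V h e f).maxGenEigenspace c := by
    have h1 : w = toEnd ℂ L V h v - a • v := by rw [toEnd_apply_apply, hv]; abel
    rw [h1]
    exact sub_mem (Module.End.mapsTo_maxGenEigenspace_of_comm (commute_casimir_h t) c hvc)
      (Submodule.smul_mem _ _ hvc)
  obtain ⟨i, m, hp, him⟩ := exists_primitive_of_eigenvector t hw0 hw
  have hcm := casimir_eigenvalue_of_primitive hp (toEnd_pow_mem (commute_casimir_e t) hwc i)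
  -- raise `v` to the same weight as the primitive vector
  have hv' : ⁅h, (toEnd ℂ L V e ^ i) v⁆ =
      (m : ℂ) • (toEnd ℂ L V e ^ i) v + (toEnd ℂ L V e ^ i) w := by
    rw [← him]
    clear hp him hcm
    induction i with
    | zero => simpa using hv
    | succ i ih =>
      simp only [pow_succ', Module.End.mul_apply, toEnd_apply_apply] at ih ⊢
      rw [lie_h_lie_e t, ih, lie_add, lie_smul]
      push_cast
      module
  set v' := (toEnd ℂ L V e ^ i) v
  set w' := (toEnd ℂ L V e ^ i) w
  have hvc' : v' ∈ (casimir V h e f).maxGenEigenspace c :=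
    toEnd_pow_mem (commute_casimir_e t) hvc i
  have hev : ⁅e, v'⁆ = 0 := by
    by_contra hne
    have h1 : ⁅h, ⁅e, v'⁆⁆ = (m + 2 : ℂ) • ⁅e, v'⁆ := by
      rw [lie_h_lie_e t, hv', lie_add, lie_smul, hp.lie_e]; module
    obtain ⟨j, m', hp', hm'⟩ := exists_primitive_of_eigenvector t hne h1
    have h2 := primitive_weight_unique hp' (toEnd_pow_mem (commute_casimir_e t)
      (Module.End.mapsTo_maxGenEigenspace_of_comm (commute_casimir_e t) c hvc') j) hcm
    rw [h2] at hm'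
    have h3 : m + 2 + 2 * j = m := by exact_mod_cast hm'
    omega
  have hfw : (toEnd ℂ L V f ^ (m + 1)) w' = 0 := hp.pow_toEnd_f_eq_zero_of_eq_nat rfl
  have hfw' : (toEnd ℂ L V f ^ m) w' ≠ 0 := hp.pow_toEnd_f_ne_zero_of_eq_nat rfl le_rfl
  have hx := lie_e_toEnd_f_pow_of_jordan t hv' hev m
  have hx0 : (toEnd ℂ L V f ^ (m + 1)) v' ≠ 0 := by
    intro h0
    rw [h0, lie_zero, sub_self, mul_zero, zero_smul, zero_add] at hx
    exact hfw' ((smul_eq_zero.1 hx.symm).resolve_left (by exact_mod_cast Nat.succ_ne_zero m))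
  have hhx : ⁅-h, (toEnd ℂ L V f ^ (m + 1)) v'⁆ = (m + 2 : ℂ) • (toEnd ℂ L V f ^ (m + 1)) v' := by
    rw [neg_lie, lie_h_toEnd_f_pow_of_jordan t hv', hfw]
    push_cast
    module
  obtain ⟨j, m', hp', hm'⟩ := exists_primitive_of_eigenvector t.symm hx0 hhx
  have h2 := primitive_weight_unique hp' (c := c) (by
    rw [casimir_symm t]
    exact toEnd_pow_mem (commute_casimir_f t) (toEnd_pow_mem (commute_casimir_f t) hvc' _) j) hcm
  rw [h2] at hm'
  have h3 : m + 2 + 2 * j = m := by exact_mod_cast hm'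
  omega

/-- The semisimple element of an `sl₂`-triple acts diagonalisably on every finite-dimensional
representation. -/
theorem maxGenEigenspace_eq_eigenspace_of_isSl2Triple [FiniteDimensional ℂ V]
    (t : IsSl2Triple h e f) (a : ℂ) :
    (toEnd ℂ L V h).maxGenEigenspace a = (toEnd ℂ L V h).eigenspace a := by
  refine le_antisymm ?_ ((Module.End.genEigenspace _ a).monotone le_top)
  -- The Casimir element commutes with `h`, so the generalised eigenspace splits further and its
  -- Casimir eigenvalue may be fixed.
  rw [Submodule.eq_iSup_inf_genEigenspace (p := (toEnd ℂ L V h).maxGenEigenspace a)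
    (f := casimir V h e f) ⊤
    (fun x hx => Module.End.mapsTo_maxGenEigenspace_of_comm (commute_casimir_h t).symm a hx)
    (Module.End.iSup_maxGenEigenspace_eq_top _)]
  refine iSup_le fun c => ?_
  rintro v ⟨hv, hvc⟩
  obtain ⟨n, hn⟩ := (Module.End.mem_maxGenEigenspace _ _ _).1 hv
  clear hv
  -- Induction on the exponent of nilpotency: `N v` is already a genuine eigenvector, which leaves a
  -- Jordan chain of length two.
  induction n generalizing v with
  | zero => simp at hn; simp [hn]
  | succ n ih =>
    set N := toEnd ℂ L V h - a • (1 : End ℂ V) with hN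
    have hNapp : ∀ x, N x = ⁅h, x⁆ - a • x := fun x => rfl
    have hNv : N v ∈ (casimir V h e f).maxGenEigenspace c :=
      sub_mem (Module.End.mapsTo_maxGenEigenspace_of_comm (commute_casimir_h t) c hvc)
        (Submodule.smul_mem _ _ hvc)
    have h1 : N v ∈ (toEnd ℂ L V h).eigenspace a := by
      refine ih hNv ?_
      rw [← Module.End.mul_apply, ← pow_succ]
      exact hn
    rw [Module.End.mem_eigenspace_iff, toEnd_apply_apply] at h1 ⊢
    have h2 := eq_zero_of_jordan t hvc (a := a) (w := N v) (by rw [hNapp]; abel) h1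
    rw [hNapp] at h2
    exact sub_eq_zero.1 h2

theorem exists_int_of_isSl2Triple [FiniteDimensional ℂ V] (t : IsSl2Triple h e f) {w : V} {a : ℂ}
    (hw0 : w ≠ 0) (hw : ⁅h, w⁆ = a • w) : ∃ z : ℤ, a = z := by
  obtain ⟨i, m, -, him⟩ := exists_primitive_of_eigenvector t hw0 hw
  exact ⟨m - 2 * i, by push_cast; rw [← him]; ring⟩

end Sl2

/-! ### Rational combinations and common denominators. -/

section Rational

theorem exists_ratProj : ∃ p : ℂ →ₗ[ℚ] ℚ, ∀ q : ℚ, p (q : ℂ) = q := by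
  obtain ⟨p, hp⟩ := LinearMap.exists_leftInverse_of_injective (Algebra.linearMap ℚ ℂ)
    (LinearMap.ker_eq_bot.2 (algebraMap ℚ ℂ).injective)
  exact ⟨p, fun q => LinearMap.congr_fun hp q⟩

theorem ratProj_mul {p : ℂ →ₗ[ℚ] ℚ} (c : ℂ) (q : ℚ) : p (c * q) = p c * q := by
  have h1 : c * (q : ℂ) = q • c := by rw [Rat.smul_def, mul_comm]
  rw [h1, map_smul, smul_eq_mul, mul_comm]

/-- A complex combination of vectors `x i` is a rational one if functionals which separate points
take rational values on it and on the `x i`. -/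
theorem exists_rat_combination {W ι κ : Type*} [AddCommGroup W] [Module ℂ W] [Fintype ι]
    (x : ι → W) (y : κ → Dual ℂ W) (hy : ∀ w, (∀ k, y k w = 0) → w = 0)
    (hyx : ∀ k i, ∃ q : ℚ, y k (x i) = q) {w : W} (hw : w ∈ Submodule.span ℂ (Set.range x))
    (hyw : ∀ k, ∃ q : ℚ, y k w = q) : ∃ c : ι → ℚ, w = ∑ i, (c i : ℂ) • x i := by
  obtain ⟨p, hp⟩ := exists_ratProj
  obtain ⟨a, rfl⟩ := (Submodule.mem_span_range_iff_exists_fun ℂ).1 hw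
  -- The projection is applied to the coefficients. It commutes with multiplication by rationals, so
  -- no `y k` sees the change, and the `y k` separate points.
  refine ⟨fun i => p (a i), sub_eq_zero.1 (hy _ fun k => ?_)⟩
  choose q hq using hyx k
  obtain ⟨r, hr⟩ := hyw k
  simp only [map_sub, map_sum, map_smul, smul_eq_mul, hq] at hr ⊢
  have h1 := congrArg p hr
  simp only [map_sum, ratProj_mul, hp] at h1
  rw [hr, ← h1]
  push_cast
  ring

theorem exists_common_denominator {ι : Type*} [Fintype ι] (c : ι → ℚ) :
    ∃ m : ℕ, 0 < m ∧ ∀ i, ∃ z : ℤ, (m : ℚ) * c i = z := by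
  refine ⟨∏ i, (c i).den, Finset.prod_pos fun i _ => (c i).den_pos, fun i => ?_⟩
  obtain ⟨k, hk⟩ := Finset.dvd_prod_of_mem (fun i => (c i).den) (Finset.mem_univ i)
  refine ⟨k * (c i).num, ?_⟩
  rw [hk]
  have := Rat.mul_den_eq_num (c i)
  push_cast
  rw [← this]
  ring

end Rational

/-! ### Exponential polynomials and replicas. -/

section ExponentialPolynomials

/-- The algebra morphism from formal exponential polynomials to `ℂ` with `e^a ↦ exp (t * p a)`. -/
def expEval (p : ℂ →+ ℂ) (t : ℂ) : AddMonoidAlgebra ℂ ℂ →ₐ[ℂ] ℂ :=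
  AddMonoidAlgebra.lift ℂ ℂ ℂ
    { toFun := fun a => Complex.exp (t * p a.toAdd)
      map_one' := by simp
      map_mul' := fun a b => by simp [mul_add, Complex.exp_add] }

theorem expEval_single (p : ℂ →+ ℂ) (t a c : ℂ) :
    expEval p t (AddMonoidAlgebra.single a c) = c * Complex.exp (t * p a) := by
  simp [expEval, AddMonoidAlgebra.lift_single]

theorem eq_of_forall_exp_eq {a b : ℂ} (hab : ∀ t : ℂ, Complex.exp (t * a) = Complex.exp (t * b)) :
    a = b := by
  have h2 : ∀ a : ℂ, HasDerivAt (fun t : ℂ => Complex.exp (t * a)) a 0 := fun a => by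
    simpa using ((hasDerivAt_id (0 : ℂ)).mul_const a).cexp
  exact (h2 a).unique (by simpa only [hab] using h2 b)

/-- Distinct exponents give distinct characters of the additive group `ℂ`, and distinct characters
are linearly independent. -/
theorem eq_zero_of_expEval {F : AddMonoidAlgebra ℂ ℂ}
    (hF : ∀ t, expEval (AddMonoidHom.id ℂ) t F = 0) : F = 0 := by
  let chi : ℂ → (Multiplicative ℂ →* ℂ) := fun a =>
    { toFun := fun t => Complex.exp (t.toAdd * a)
      map_one' := by simp
      map_mul' := fun s t => by simp [add_mul, Complex.exp_add] }
  have hchi : Function.Injective chi := fun a b hab =>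
    eq_of_forall_exp_eq fun t => DFunLike.congr_fun hab (Multiplicative.ofAdd t)
  have hli := (linearIndependent_monoidHom (Multiplicative ℂ) ℂ).comp chi hchi
  have h0 : ∀ i ∈ F.coeff.support, F.coeff i = 0 := by
    refine linearIndependent_iff'.1 hli F.coeff.support F.coeff ?_
    ext t
    have h1 := hF t.toAdd
    rw [expEval, AddMonoidAlgebra.lift_apply] at h1
    simpa [Finsupp.sum, chi] using h1
  ext a
  by_contra ha
  exact ha (by simpa using h0 a (by simpa using ha))

/-- If a polynomial vanishes along a curve whose coordinates are combinations of exponentials, then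
it still vanishes after applying an additive map to the exponents. -/
theorem eval_exp_replica {σ ι : Type*} [Fintype ι] (A : σ → ι → ℂ) (mu : ι → ℂ) (p : ℂ →+ ℂ)
    (P : MvPolynomial σ ℂ)
    (hP : ∀ t : ℂ, MvPolynomial.eval (fun s => ∑ i, A s i * Complex.exp (t * mu i)) P = 0) (t : ℂ) :
    MvPolynomial.eval (fun s => ∑ i, A s i * Complex.exp (t * p (mu i))) P = 0 := by
  -- The curve is lifted to the group algebra of `(ℂ, +)`. There `P(M)` is zero itself, so it is
  -- killed by every evaluation, including those that twist the exponents by `p`.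
  let M : σ → AddMonoidAlgebra ℂ ℂ := fun s => ∑ i, AddMonoidAlgebra.single (mu i) (A s i)
  have key : ∀ (p : ℂ →+ ℂ) (t : ℂ), expEval p t (MvPolynomial.aeval M P) =
      MvPolynomial.eval (fun s => ∑ i, A s i * Complex.exp (t * p (mu i))) P := by
    intro p t
    have h1 : (expEval p t).comp (MvPolynomial.aeval M) =
        MvPolynomial.aeval fun s => ∑ i, A s i * Complex.exp (t * p (mu i)) := by
      ext s
      simp [M, map_sum, expEval_single]
    rw [← MvPolynomial.coe_aeval_eq_eval, ← h1]
    rfl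
  rw [← key, eq_zero_of_expEval (F := MvPolynomial.aeval M P), map_zero]
  intro t
  rw [key]
  exact hP t

end ExponentialPolynomials

/-! ### Diagonal entries and exponentials of triangular matrices. -/

section Triangular

variable {n α : Type*} [Fintype n] [DecidableEq n] [LinearOrder α] {b : n → α}
  {M M' : Matrix n n ℂ}

/-- As `b` is injective, block triangular means triangular for a total order of the indices. -/
theorem mul_apply_diag_of_blockTriangular (hb : Function.Injective b) (hM : M.BlockTriangular b)
    (hM' : M'.BlockTriangular b) (k : n) : (M * M') k k = M k k * M' k k := by
  rw [Matrix.mul_apply]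
  refine Finset.sum_eq_single k (fun j _ hj => ?_) (by simp)
  rcases lt_or_gt_of_ne (fun h => hj (hb h) : b j ≠ b k) with h | h
  · rw [hM h, zero_mul]
  · rw [hM' h, mul_zero]

theorem pow_apply_diag_of_blockTriangular (hb : Function.Injective b) (hM : M.BlockTriangular b)
    (k : n) (i : ℕ) : (M ^ i) k k = M k k ^ i := by
  induction i with
  | zero => simp
  | succ i ih => rw [pow_succ, mul_apply_diag_of_blockTriangular hb (hM.pow i) hM, ih, pow_succ]

open scoped Matrix.Norms.Operator in
theorem exp_apply_diag_of_blockTriangular (hb : Function.Injective b) (hM : M.BlockTriangular b)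
    (k : n) : NormedSpace.exp M k k = Complex.exp (M k k) := by
  have h1 := NormedSpace.exp_series_hasSum_exp' (𝕂 := ℂ) M
  have h2 := NormedSpace.exp_series_hasSum_exp' (𝕂 := ℂ) (M k k)
  have h3 := h1.map (Matrix.entryAddMonoidHom ℂ k k) (continuous_id.matrix_elem k k)
  rw [Complex.exp_eq_exp_ℂ]
  refine h3.unique ?_
  have h4 : ((Matrix.entryAddMonoidHom ℂ k k) ∘ fun i : ℕ => ((i.factorial : ℂ)⁻¹) • M ^ i) =
      fun i : ℕ => ((i.factorial : ℂ)⁻¹) • M k k ^ i := by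
    funext i
    rw [← pow_apply_diag_of_blockTriangular hb hM]
    rfl
  exact h4 ▸ h2

-- The derivative at `t = 0` of the vanishing entry is the entry of `M`.
open scoped Matrix.Norms.Operator in
theorem apply_eq_zero_of_exp_smul {k l : n} (h : ∀ t : ℂ, NormedSpace.exp (t • M) k l = 0) :
    M k l = 0 := by
  have h1 := ((Matrix.entryLinearMap ℂ ℂ k l).toContinuousLinearMap).hasFDerivAt.comp_hasDerivAt
    (0 : ℂ) (hasDerivAt_exp_smul_const M (0 : ℂ))
  have h2 := h1.unique ((hasDerivAt_const (0 : ℂ) (0 : ℂ)).congr_of_eventuallyEq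
    (Filter.Eventually.of_forall h))
  rw [zero_smul, NormedSpace.exp_zero, one_mul] at h2
  exact h2

end Triangular

/-! ### Change of basis for matrices. -/

section Conj

variable {N : ℕ}

/-- Matrices with respect to the basis of `ℂ^N` formed by the columns of `P`. -/
def conjHom (P : GL (Fin N) ℂ) :
    Matrix (Fin N) (Fin N) ℂ →ₐ[ℂ] Matrix (Fin N) (Fin N) ℂ :=
  AlgHom.ofLinearMap
    { toFun := fun M => (P⁻¹ : GL (Fin N) ℂ).1 * M * P.1
      map_add' := fun a c => by rw [mul_add, add_mul]
      map_smul' := fun a c => by simp }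
    (by simp)
    (fun a c => by
      simp only [LinearMap.coe_mk, AddHom.coe_mk]
      rw [show (P⁻¹ : GL (Fin N) ℂ).1 * a * P.1 * ((P⁻¹ : GL (Fin N) ℂ).1 * c * P.1) =
        (P⁻¹ : GL (Fin N) ℂ).1 * a * (P.1 * (P⁻¹ : GL (Fin N) ℂ).1) * c * P.1 by noncomm_ring,
        Units.mul_inv]
      noncomm_ring)

theorem conjHom_apply (P : GL (Fin N) ℂ) (M : Matrix (Fin N) (Fin N) ℂ) :
    conjHom P M = (P⁻¹ : GL (Fin N) ℂ).1 * M * P.1 := rfl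

theorem eq_of_conjHom (P : GL (Fin N) ℂ) (M : Matrix (Fin N) (Fin N) ℂ) :
    M = P.1 * conjHom P M * (P⁻¹ : GL (Fin N) ℂ).1 := by
  rw [conjHom_apply, ← mul_assoc, ← mul_assoc, Units.mul_inv, one_mul, mul_assoc, Units.mul_inv,
    mul_one]

theorem conjHom_injective (P : GL (Fin N) ℂ) : Function.Injective (conjHom P) := fun M M' h => by
  rw [eq_of_conjHom P M, h, ← eq_of_conjHom]

theorem conjHom_exp (P : GL (Fin N) ℂ) (M : Matrix (Fin N) (Fin N) ℂ) :
    conjHom P (NormedSpace.exp M) = NormedSpace.exp (conjHom P M) :=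
  (Matrix.exp_units_conj' P M).symm

end Conj

/-! ### Weight bases and triangularity of the root spaces. -/

section Frame

variable {N : ℕ} {g : LieSubalgebra ℂ (Matrix (Fin N) (Fin N) ℂ)} [LieAlgebra.HasTrivialRadical ℂ g]
  (h : LieSubalgebra ℂ g) [h.IsCartanSubalgebra]

/-- A basis of `ℂ^N` consisting of weight vectors for `h`, with integral weights. -/
structure WeightFrame where
  /-- the matrix whose columns are the weight vectors -/
  P : GL (Fin N) ℂ
  /-- the weights -/
  lam : Fin N → Dual ℂ h
  conj_eq : ∀ x : h, conjHom P ((x : g) : Matrix (Fin N) (Fin N) ℂ) =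
    Matrix.diagonal fun k => lam k x
  integral : ∀ k, ∀ i : h.root, ∃ z : ℤ, lam k ((roots h).coroot i) = z

/-- A matrix as an endomorphism of `ℂ^N`. -/
def matEnd : Matrix (Fin N) (Fin N) ℂ →ₗ⁅ℂ⁆ End ℂ (Fin N → ℂ) where
  toLinearMap := Matrix.toLin'.toLinearMap
  map_lie' := fun {x y} => by
    change Matrix.toLin' (x * y - y * x) = _
    rw [map_sub, Matrix.toLin'_mul, Matrix.toLin'_mul]
    rfl

variable {h}

theorem exists_sl2Triple_coroot (i : h.root) : ∃ e f : End ℂ (Fin N → ℂ),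
    IsSl2Triple (matEnd (((roots h).coroot i : g) : Matrix (Fin N) (Fin N) ℂ)) e f := by
  have hi : (i : LieModule.Weight ℂ h g).IsNonZero := (Finset.mem_filter.1 i.2).2
  obtain ⟨x, e, f, t, he, hf⟩ := LieAlgebra.IsKilling.exists_isSl2Triple_of_weight_isNonZero hi
  have hx := t.h_eq_coroot hi he hf
  let F : g →ₗ⁅ℂ⁆ End ℂ (Fin N → ℂ) := matEnd.comp g.incl
  have hF : Function.Injective F :=
    (Matrix.toLin' (R := ℂ)).injective.comp Subtype.val_injective
  have hx' : F x = matEnd (((roots h).coroot i : g) : Matrix (Fin N) (Fin N) ℂ) := by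
    rw [hx]; rfl
  rw [← hx']
  refine ⟨F e, F f, fun h0 => t.h_ne_zero (hF (h0.trans (map_zero F).symm)), ?_, ?_, ?_⟩
  · rw [← LieHom.map_lie, t.lie_e_f]
  · rw [← LieHom.map_lie, t.lie_h_e_nsmul, map_nsmul]
  · rw [← LieHom.map_lie, t.lie_h_f_nsmul, map_neg, map_nsmul]

theorem cartan_commute (x y : h) :
    ((x : g) : Matrix (Fin N) (Fin N) ℂ) * ((y : g) : Matrix (Fin N) (Fin N) ℂ) =
      ((y : g) : Matrix (Fin N) (Fin N) ℂ) * ((x : g) : Matrix (Fin N) (Fin N) ℂ) := by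
  have h1 : ⁅x, y⁆ = 0 := LieModule.IsTrivial.trivial x y
  have h2 := congrArg (fun z : h => ((z : g) : Matrix (Fin N) (Fin N) ℂ)) h1
  exact sub_eq_zero.1 h2

/-- The simple coroots act by commuting operators, each diagonalisable by the `sl₂` argument, so
joint eigenvectors span `ℂ^N`. -/
theorem exists_weightFrame (b : (roots h).Base) : Nonempty (WeightFrame h) := by
  let rho : h →ₗ[ℂ] End ℂ (Fin N → ℂ) :=
    (Matrix.toLin' (R := ℂ)).toLinearMap ∘ₗ
      g.toSubmodule.subtype ∘ₗ h.toSubmodule.subtype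
  have hrho : ∀ x v, rho x v = ((x : g) : Matrix (Fin N) (Fin N) ℂ).mulVec v := fun x v => rfl
  let F : b.support → End ℂ (Fin N → ℂ) := fun i => rho ((roots h).coroot i)
  let S : Set (Fin N → ℂ) := {v | ∃ lam : Dual ℂ h, ∀ x, rho x v = lam x • v}
  have hS : ⊤ ≤ Submodule.span ℂ S := by
    rw [← Module.End.iSup_iInf_maxGenEigenspace_eq_top_of_iSup_maxGenEigenspace_eq_top_of_commute F
      ?_ fun i => Module.End.iSup_maxGenEigenspace_eq_top _]
    · refine iSup_le fun chi v hv => Submodule.subset_span ?_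
      -- Simple coroots form a basis of the Cartan subalgebra, so the joint eigenvalues extend to a
      -- linear functional.
      refine ⟨b.toCoweightBasis.constr ℂ chi, ?_⟩
      suffices h1 : rho.flip v = ((b.toCoweightBasis.constr ℂ chi).smulRight v) from
        fun x => LinearMap.congr_fun h1 x
      refine b.toCoweightBasis.ext fun i => ?_
      rw [LinearMap.smulRight_apply, Basis.constr_basis, LinearMap.flip_apply,
        RootPairing.Base.toCoweightBasis_apply]
      have h2 := (Submodule.mem_iInf _).1 hv i
      obtain ⟨e, f, t⟩ := exists_sl2Triple_coroot (h := h) (i : h.root)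
      have h3 := maxGenEigenspace_eq_eigenspace_of_isSl2Triple (V := Fin N → ℂ) t (chi i)
      have h5 : v ∈ (F i).eigenspace (chi i) := h3 ▸ h2
      exact Module.End.mem_eigenspace_iff.1 h5
    · intro i j _
      refine LinearMap.ext fun v => ?_
      simp only [F, Module.End.mul_apply, hrho, Matrix.mulVec_mulVec]
      rw [cartan_commute]
  let B0 := Basis.ofSpan hS
  have : Fintype ((linearIndepOn_empty ℂ id).extend (Set.empty_subset S)) :=
    FiniteDimensional.fintypeBasisIndex B0
  have hcard : Fintype.card ((linearIndepOn_empty ℂ id).extend (Set.empty_subset S)) = N := by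
    rw [← Module.finrank_eq_card_basis B0, Module.finrank_fin_fun]
  let B : Basis (Fin N) ℂ (Fin N → ℂ) := B0.reindex (Fintype.equivFinOfCardEq hcard)
  have hB : ∀ k, B k ∈ S := fun k => Basis.ofSpan_subset hS ⟨_, (B0.reindex_apply _ k).symm⟩
  choose lam hlam using hB
  have := (Pi.basisFun ℂ (Fin N)).invertibleToMatrix B
  let P : GL (Fin N) ℂ := unitOfInvertible ((Pi.basisFun ℂ (Fin N)).toMatrix B)
  have hP : ∀ j k, P.1 j k = B k j := fun j k => rfl
  refine ⟨⟨P, lam, fun x => ?_, fun k i => ?_⟩⟩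
  · have h1 : ((x : g) : Matrix (Fin N) (Fin N) ℂ) * P.1 =
        P.1 * Matrix.diagonal fun k => lam k x := by
      ext j k
      rw [Matrix.mul_diagonal, hP]
      have h2 := congrFun (hlam k x) j
      rw [hrho] at h2
      rw [mul_comm]
      exact h2
    rw [conjHom_apply, mul_assoc, h1, ← mul_assoc, Units.inv_mul, one_mul]
  · obtain ⟨e, f, t⟩ := exists_sl2Triple_coroot (h := h) i
    exact exists_int_of_isSl2Triple t (B.ne_zero k) (hlam k ((roots h).coroot i))

namespace WeightFrame

variable (w : WeightFrame h)

theorem eq_zero_of_lam {x : h} (hx : ∀ k, w.lam k x = 0) : x = 0 := by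
  have h1 : conjHom w.P ((x : g) : Matrix (Fin N) (Fin N) ℂ) = conjHom w.P 0 := by
    rw [w.conj_eq, map_zero]
    ext i j
    simp [Matrix.diagonal_apply, hx]
  exact Subtype.ext (Subtype.ext (conjHom_injective w.P h1))

theorem span_lam : Submodule.span ℂ (Set.range w.lam) = ⊤ := by
  rw [← Subspace.dualCoannihilator_dualAnnihilator_eq (W := Submodule.span ℂ (Set.range w.lam)),
    show (Submodule.span ℂ (Set.range w.lam)).dualCoannihilator = ⊥ from ?_,
    Submodule.dualAnnihilator_bot]
  refine (Submodule.eq_bot_iff _).2 fun x hx => w.eq_zero_of_lam fun k => ?_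
  exact (Submodule.mem_dualCoannihilator x).1 hx _ (Submodule.subset_span ⟨k, rfl⟩)

/-- This is the `(k, l)` entry of `[a, x] = α(a) x`: a root vector has a nonzero entry only where
`λ_k - λ_l` is the root. -/
theorem conj_rootSpace_apply {i : h.root} {x : g}
    (hx : x ∈ LieAlgebra.rootSpace h ((roots h).root i)) (a : h) (k l : Fin N) :
    (w.lam k a - w.lam l a - (roots h).root i a) *
      conjHom w.P (x : Matrix (Fin N) (Fin N) ℂ) k l = 0 := by
  have h1 : ⁅(a : g), x⁆ = (roots h).root i a • x :=
    LieAlgebra.IsKilling.lie_eq_smul_of_mem_rootSpace hx a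
  have h2 : ((a : g) : Matrix (Fin N) (Fin N) ℂ) * (x : Matrix (Fin N) (Fin N) ℂ) -
      (x : Matrix (Fin N) (Fin N) ℂ) * ((a : g) : Matrix (Fin N) (Fin N) ℂ) =
      (roots h).root i a • (x : Matrix (Fin N) (Fin N) ℂ) :=
    congrArg (fun z : g => (z : Matrix (Fin N) (Fin N) ℂ)) h1
  have h3 := congrFun (congrFun (congrArg (conjHom w.P) h2) k) l
  rw [map_sub, map_mul, map_mul, map_smul, w.conj_eq, Matrix.sub_apply, Matrix.diagonal_mul,
    Matrix.mul_diagonal, Matrix.smul_apply, smul_eq_mul] at h3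
  linear_combination h3

end WeightFrame

/-- Under biduality, this is the functional with value 1 at every simple root. -/
theorem exists_height_element (b : (roots h).Base) :
    ∃ rho : h, ∀ i, (roots h).root i rho = b.height i := by
  let F : Dual ℂ (Dual ℂ h) := b.toWeightBasis.constr ℂ fun _ => (1 : ℂ)
  refine ⟨(Module.evalEquiv ℂ h).symm F, fun i => ?_⟩
  rw [Module.apply_evalEquiv_symm_apply]
  obtain ⟨f, -, -, hf⟩ := b.exists_root_eq_sum_int i
  rw [b.height_eq_sum hf, hf, map_sum]
  push_cast
  refine Finset.sum_congr rfl fun j hj => ?_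
  rw [map_zsmul, ← b.toWeightBasis_apply ⟨j, hj⟩, Basis.constr_basis]
  simp

namespace WeightFrame

variable (w : WeightFrame h) (b : (roots h).Base)

/-- A total order on the weight vectors for which positive root vectors are strictly upper
triangular. -/
def order (k : Fin N) : ℝ ×ₗ Fin N :=
  -- Heights are real, so real parts suffice to compare weights; the index breaks ties and makes the
  -- order total.
  toLex (-(w.lam k (exists_height_element b).choose).re, k)

theorem order_injective : Function.Injective (w.order b) := fun k l hkl => by
  have := congrArg (fun z => (ofLex z).2) hkl
  exact this

theorem conj_rootSum_apply {S : Set h.root} {x : g} (hx : x ∈ rootSum S) {k l : Fin N}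
    (hkl : ∀ i ∈ S, (w.lam k (exists_height_element b).choose).re -
      (w.lam l (exists_height_element b).choose).re ≠ b.height i) :
    conjHom w.P (x : Matrix (Fin N) (Fin N) ℂ) k l = 0 := by
  rw [rootSum] at hx
  induction hx using Submodule.iSup_induction' with
  | zero => rw [ZeroMemClass.coe_zero, map_zero, Matrix.zero_apply]
  | add a c _ _ ha hc =>
    rw [AddMemClass.coe_add, map_add, Matrix.add_apply, ha, hc, add_zero]
  | mem i x hx =>
    by_cases hi : i ∈ S
    swap
    · simp only [hi, iSup_neg, not_false_eq_true, Submodule.mem_bot] at hx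
      rw [hx, ZeroMemClass.coe_zero, map_zero, Matrix.zero_apply]
    simp only [hi, iSup_pos] at hx
    have h1 := w.conj_rootSpace_apply hx (exists_height_element b).choose k l
    rw [(exists_height_element b).choose_spec i] at h1
    refine (mul_eq_zero.1 h1).resolve_left fun h2 => hkl i hi ?_
    have h3 := congrArg Complex.re h2
    simp only [Complex.sub_re, Complex.intCast_re, Complex.zero_re] at h3
    linarith

theorem re_le_of_order_le {k l : Fin N} (hkl : w.order b l ≤ w.order b k) :
    (w.lam k (exists_height_element b).choose).re ≤
      (w.lam l (exists_height_element b).choose).re := by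
  have := Prod.Lex.monotone_fst _ _ hkl
  simpa [order] using this

theorem conj_nPos_apply {x : g} (hx : x ∈ nPos b) {k l : Fin N}
    (hkl : w.order b l ≤ w.order b k) :
    conjHom w.P (x : Matrix (Fin N) (Fin N) ℂ) k l = 0 := by
  refine w.conj_rootSum_apply b hx fun i hi => ?_
  have h1 := w.re_le_of_order_le b hkl
  have h2 : (0 : ℝ) < b.height i := by exact_mod_cast hi
  linarith

theorem conj_nNeg_apply {x : g} (hx : x ∈ nNeg b) {k l : Fin N}
    (hkl : w.order b k ≤ w.order b l) :
    conjHom w.P (x : Matrix (Fin N) (Fin N) ℂ) k l = 0 := by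
  refine w.conj_rootSum_apply b hx fun i hi => ?_
  have h1 := w.re_le_of_order_le b hkl
  have h2 : b.height i < 0 :=
    lt_of_le_of_ne (not_lt.1 fun h => hi ((b.isPos_iff).2 h)) (b.height_ne_zero i)
  have h3 : (b.height i : ℝ) < 0 := by exact_mod_cast h2
  linarith

end WeightFrame

theorem exists_triangular_decomposition (b : (roots h).Base) (x : g) :
    ∃ a : h, ∃ p ∈ nPos b, ∃ q ∈ nNeg b, x = a + p + q := by
  have hx : x ∈ (⊤ : LieSubmodule ℂ h g) := LieSubmodule.mem_top x
  rw [← LieModule.iSup_genWeightSpace_eq_top' ℂ h g] at hx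
  suffices h1 : x ∈ h.toSubmodule ⊔ nPos b ⊔ nNeg b by
    obtain ⟨y, hy, q, hq, rfl⟩ := Submodule.mem_sup.1 h1
    obtain ⟨a, ha, p, hp, rfl⟩ := Submodule.mem_sup.1 hy
    exact ⟨⟨a, ha⟩, p, hp, q, hq, rfl⟩
  rw [← LieSubmodule.mem_toSubmodule, LieSubmodule.iSup_toSubmodule] at hx
  refine (iSup_le fun i => ?_ : _ ≤ h.toSubmodule ⊔ nPos b ⊔ nNeg b) hx
  by_cases hi : i.IsZero
  · refine le_trans ?_ (le_sup_left.trans le_sup_left)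
    intro y hy
    rw [hi.eq, LieSubmodule.mem_toSubmodule] at hy
    exact (LieAlgebra.rootSpace_zero_eq ℂ g h).le hy
  · have hi' : i ∈ h.root := by simpa using hi
    by_cases hpos : b.IsPos ⟨i, hi'⟩
    · refine le_trans ?_ (le_sup_right.trans le_sup_left)
      exact le_iSup₂_of_le (f := fun (j : h.root) (_ : j ∈ {j | b.IsPos j}) =>
        (LieAlgebra.rootSpace h ((roots h).root j)).toSubmodule) ⟨i, hi'⟩ hpos le_rfl
    · refine le_trans ?_ le_sup_right
      exact le_iSup₂_of_le (f := fun (j : h.root) (_ : j ∈ {j | ¬ b.IsPos j}) =>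
        (LieAlgebra.rootSpace h ((roots h).root j)).toSubmodule) ⟨i, hi'⟩ hpos le_rfl

end Frame

/-! ### The analytic subgroups `A`, `H`, `G_r` and the group `Γ`. -/

section Groups

variable {N : ℕ} {g : LieSubalgebra ℂ (Matrix (Fin N) (Fin N) ℂ)} [LieAlgebra.HasTrivialRadical ℂ g]
  {h : LieSubalgebra ℂ g} [h.IsCartanSubalgebra]

/-- The exponential of an element of the Cartan subalgebra. -/
def expCartan (x : h) : GL (Fin N) ℂ := expGL ((x : g) : Matrix (Fin N) (Fin N) ℂ)

theorem expCartan_add (x y : h) : expCartan (x + y) = expCartan x * expCartan y := by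
  ext1
  exact Matrix.exp_add_of_commute _ _ (cartan_commute x y)

theorem expCartan_zero : expCartan (0 : h) = 1 := by
  ext1
  exact NormedSpace.exp_zero

theorem expCartan_neg (x : h) : expCartan (-x) = (expCartan x)⁻¹ := by
  rw [eq_inv_iff_mul_eq_one, ← expCartan_add, neg_add_cancel, expCartan_zero]

theorem expCartan_nsmul (x : h) (n : ℕ) : expCartan (n • x) = expCartan x ^ n := by
  induction n with
  | zero => rw [zero_smul, expCartan_zero, pow_zero]
  | succ n ih => rw [succ_nsmul, expCartan_add, ih, pow_succ]

namespace WeightFrame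

variable (w : WeightFrame h) (b : (roots h).Base)

theorem conj_expCartan (x : h) : conjHom w.P (expCartan x : GL (Fin N) ℂ).1 =
    Matrix.diagonal fun k => Complex.exp (w.lam k x) := by
  rw [expCartan, coe_expGL, conjHom_exp, w.conj_eq, Matrix.exp_diagonal]
  congr 1
  ext k
  rw [Pi.coe_exp, Complex.exp_eq_exp_ℂ]

theorem eq_expCartan {γ : GL (Fin N) ℂ} {x : h}
    (hγ : conjHom w.P γ.1 = Matrix.diagonal fun k => Complex.exp (w.lam k x)) :
    γ = expCartan x := by
  ext1
  exact conjHom_injective w.P (hγ.trans (w.conj_expCartan x).symm)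

theorem expCartan_eq {x y : h} (hxy : ∀ k, Complex.exp (w.lam k x) = Complex.exp (w.lam k y)) :
    expCartan x = expCartan y := by
  refine w.eq_expCartan ?_
  rw [w.conj_expCartan]
  congr 1
  exact funext hxy

theorem exp_lam_eq {x y : h} (hxy : expCartan x = expCartan y) (k : Fin N) :
    Complex.exp (w.lam k x) = Complex.exp (w.lam k y) := by
  have h1 := w.conj_expCartan x
  rw [hxy, w.conj_expCartan y] at h1
  exact (congrFun (Matrix.diagonal_injective h1) k).symm

end WeightFrame

variable (B : LinearMap.BilinForm ℂ g) (u : h ⊗[ℂ] h)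

theorem expProd_theta (x : h) : expProd (theta B u x) =
    (expCartan (x - endOf B u x), expCartan (-(endOf B u x + x))) := by
  rw [theta_apply, ← neg_sub (endOf B u x) x]
  rfl

/-- Since `𝔞` is abelian, its exponentials already form a group. -/
theorem mem_analyticSubgroup_aLie {p : GL (Fin N) ℂ × GL (Fin N) ℂ} :
    p ∈ analyticSubgroup (aLie B u) ↔
      ∃ x : h, p = (expCartan (x - endOf B u x), expCartan (-(endOf B u x + x))) := by
  constructor
  · intro hp
    induction hp using Subgroup.closure_induction with
    | mem p hp =>
      obtain ⟨_, ⟨x, rfl⟩, rfl⟩ := hp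
      exact ⟨x, expProd_theta B u x⟩
    | one => exact ⟨0, by simp [expCartan_zero, Prod.one_eq_mk]⟩
    | mul p q _ _ hp hq =>
      obtain ⟨x, rfl⟩ := hp
      obtain ⟨y, rfl⟩ := hq
      refine ⟨x + y, ?_⟩
      rw [Prod.mk_mul_mk, ← expCartan_add, ← expCartan_add, map_add]
      congr 2 <;> abel
    | inv p _ hp =>
      obtain ⟨x, rfl⟩ := hp
      refine ⟨-x, ?_⟩
      rw [Prod.inv_mk, ← expCartan_neg, ← expCartan_neg, map_neg]
      congr 2 <;> abel
  · rintro ⟨x, rfl⟩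
    exact Subgroup.subset_closure ⟨theta B u x, ⟨x, rfl⟩, expProd_theta B u x⟩

theorem mem_analyticSubgroup_diagLie {p : GL (Fin N) ℂ × GL (Fin N) ℂ} :
    p ∈ analyticSubgroup (diagLie h) ↔ ∃ x : h, p = (expCartan x, expCartan x) := by
  constructor
  · intro hp
    induction hp using Subgroup.closure_induction with
    | mem p hp =>
      obtain ⟨_, ⟨x, hx, rfl⟩, rfl⟩ := hp
      exact ⟨⟨x, hx⟩, rfl⟩
    | one => exact ⟨0, by simp [expCartan_zero, Prod.one_eq_mk]⟩
    | mul p q _ _ hp hq =>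
      obtain ⟨x, rfl⟩ := hp
      obtain ⟨y, rfl⟩ := hq
      exact ⟨x + y, by rw [Prod.mk_mul_mk, ← expCartan_add]⟩
    | inv p _ hp =>
      obtain ⟨x, rfl⟩ := hp
      exact ⟨-x, by rw [Prod.inv_mk, ← expCartan_neg]⟩
  · rintro ⟨x, rfl⟩
    exact Subgroup.subset_closure ⟨((x : g), (x : g)), ⟨x, x.2, rfl⟩, rfl⟩

theorem mem_Gam {p : GL (Fin N) ℂ × GL (Fin N) ℂ} : p ∈ Gam B u ↔
    ∃ x : h, p = (expCartan (x - endOf B u x), expCartan (-(endOf B u x + x))) ∧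
      expCartan (x - endOf B u x) = expCartan (-(endOf B u x + x)) := by
  rw [Gam, Subgroup.mem_inf, mem_analyticSubgroup_aLie, mem_analyticSubgroup_diagLie]
  constructor
  · rintro ⟨⟨x, rfl⟩, y, hy⟩
    exact ⟨x, rfl, (congrArg Prod.fst hy).trans (congrArg Prod.snd hy).symm⟩
  · rintro ⟨x, rfl, hx⟩
    exact ⟨⟨x, rfl⟩, _, by rw [← hx]⟩

theorem theta_mem_gr (b : (roots h).Base) (x : h) : theta B u x ∈ gr b B u :=
  Submodule.mem_sup_left (T := (nPos b).prod (nNeg b)) ⟨x, rfl⟩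

theorem mem_gr {b : (roots h).Base} {X : g × g} : X ∈ gr b B u ↔ ∃ x : h, ∃ p ∈ nPos b,
    ∃ q ∈ nNeg b, X = (((x - endOf B u x : h) : g) + p, ((-(endOf B u x + x) : h) : g) + q) := by
  have h1 : ∀ x : h, theta B u x = (((x - endOf B u x : h) : g), ((-(endOf B u x + x) : h) : g)) := by
    intro x
    rw [theta_apply, ← neg_sub (endOf B u x) x]
    rfl
  constructor
  · intro hX
    obtain ⟨_, ⟨x, rfl⟩, n, hn, rfl⟩ := Submodule.mem_sup.1 hX
    exact ⟨x, n.1, hn.1, n.2, hn.2, by rw [h1]; rfl⟩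
  · rintro ⟨x, p, hp, q, hq, rfl⟩
    exact Submodule.mem_sup.2 ⟨theta B u x, ⟨x, rfl⟩, (p, q), ⟨hp, hq⟩, by rw [h1]; rfl⟩

namespace WeightFrame

variable (w : WeightFrame h) (b : (roots h).Base)

theorem conj_add_nPos (a : h) {p : g} (hp : p ∈ nPos b) :
    (conjHom w.P (((a : g) + p : g) : Matrix (Fin N) (Fin N) ℂ)).BlockTriangular (w.order b) ∧
      ∀ k, conjHom w.P (((a : g) + p : g) : Matrix (Fin N) (Fin N) ℂ) k k = w.lam k a := by
  rw [AddMemClass.coe_add, map_add, w.conj_eq]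
  refine ⟨(Matrix.blockTriangular_diagonal _).add fun k l hkl => w.conj_nPos_apply b hp hkl.le,
    fun k => ?_⟩
  rw [Matrix.add_apply, w.conj_nPos_apply b hp le_rfl, add_zero, Matrix.diagonal_apply_eq]

theorem conj_add_nNeg (a : h) {q : g} (hq : q ∈ nNeg b) :
    (conjHom w.P (((a : g) + q : g) : Matrix (Fin N) (Fin N) ℂ)).BlockTriangular
        (OrderDual.toDual ∘ w.order b) ∧
      ∀ k, conjHom w.P (((a : g) + q : g) : Matrix (Fin N) (Fin N) ℂ) k k = w.lam k a := by
  rw [AddMemClass.coe_add, map_add, w.conj_eq]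
  refine ⟨(Matrix.blockTriangular_diagonal _).add fun k l hkl =>
    w.conj_nNeg_apply b hq (OrderDual.toDual_lt_toDual.1 hkl).le, fun k => ?_⟩
  rw [Matrix.add_apply, w.conj_nNeg_apply b hq le_rfl, add_zero, Matrix.diagonal_apply_eq]

theorem conj_exp_add_nPos (a : h) {p : g} (hp : p ∈ nPos b) :
    (conjHom w.P (expGL (((a : g) + p : g) : Matrix (Fin N) (Fin N) ℂ)).1).BlockTriangular
        (w.order b) ∧
      ∀ k, conjHom w.P (expGL (((a : g) + p : g) : Matrix (Fin N) (Fin N) ℂ)).1 k k =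
        Complex.exp (w.lam k a) := by
  obtain ⟨h1, h2⟩ := w.conj_add_nPos b a hp
  rw [coe_expGL, conjHom_exp]
  refine ⟨h1.exp, fun k => ?_⟩
  rw [exp_apply_diag_of_blockTriangular (w.order_injective b) h1, h2]

theorem dual_order_injective : Function.Injective (OrderDual.toDual ∘ w.order b) :=
  OrderDual.toDual.injective.comp (w.order_injective b)

theorem conj_exp_add_nNeg (a : h) {q : g} (hq : q ∈ nNeg b) :
    (conjHom w.P (expGL (((a : g) + q : g) : Matrix (Fin N) (Fin N) ℂ)).1).BlockTriangular
        (OrderDual.toDual ∘ w.order b) ∧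
      ∀ k, conjHom w.P (expGL (((a : g) + q : g) : Matrix (Fin N) (Fin N) ℂ)).1 k k =
        Complex.exp (w.lam k a) := by
  obtain ⟨h1, h2⟩ := w.conj_add_nNeg b a hq
  rw [coe_expGL, conjHom_exp]
  refine ⟨h1.exp, fun k => ?_⟩
  rw [exp_apply_diag_of_blockTriangular (w.dual_order_injective b) h1, h2]

/-- The pairs of an upper and a lower triangular matrix with respect to a weight basis. -/
def triangular : Subgroup (GL (Fin N) ℂ × GL (Fin N) ℂ) where
  carrier := {p | (conjHom w.P p.1.1).BlockTriangular (w.order b) ∧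
    (conjHom w.P p.2.1).BlockTriangular (OrderDual.toDual ∘ w.order b)}
  one_mem' := by
    simp only [Set.mem_ofPred_eq, Prod.fst_one, Prod.snd_one, Units.val_one, map_one]
    exact ⟨Matrix.blockTriangular_one, Matrix.blockTriangular_one⟩
  mul_mem' := by
    rintro p q ⟨hp1, hp2⟩ ⟨hq1, hq2⟩
    simp only [Set.mem_ofPred_eq, Prod.fst_mul, Prod.snd_mul, Units.val_mul, map_mul]
    exact ⟨hp1.mul hq1, hp2.mul hq2⟩
  inv_mem' := by
    have key : ∀ {α : Type} [LinearOrder α] (σ : Fin N → α) (γ : GL (Fin N) ℂ),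
        (conjHom w.P γ.1).BlockTriangular σ → (conjHom w.P (γ⁻¹).1).BlockTriangular σ := by
      intro α _ σ γ hγ
      let v : GL (Fin N) ℂ := Units.map (conjHom w.P : _ →* Matrix (Fin N) (Fin N) ℂ) γ
      have := v.invertible
      have h1 := Matrix.blockTriangular_inv_of_blockTriangular (M := v.1) hγ
      rw [← Matrix.coe_units_inv] at h1
      exact h1
    rintro p ⟨hp1, hp2⟩
    exact ⟨key _ _ hp1, key _ _ hp2⟩

variable {w b}

theorem triangular_mul_diag {p q : GL (Fin N) ℂ × GL (Fin N) ℂ} (hp : p ∈ w.triangular b)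
    (hq : q ∈ w.triangular b) (k : Fin N) :
    conjHom w.P (p * q).1.1 k k = conjHom w.P p.1.1 k k * conjHom w.P q.1.1 k k ∧
    conjHom w.P (p * q).2.1 k k = conjHom w.P p.2.1 k k * conjHom w.P q.2.1 k k := by
  simp only [Prod.fst_mul, Prod.snd_mul, Units.val_mul, map_mul]
  exact ⟨mul_apply_diag_of_blockTriangular (w.order_injective b) hp.1 hq.1 k,
    mul_apply_diag_of_blockTriangular (w.dual_order_injective b) hp.2 hq.2 k⟩

variable (w b)

theorem expProd_gr {X : g × g} (hX : X ∈ gr b B u) : expProd X ∈ w.triangular b ∧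
    ∃ x : h, ∀ k, conjHom w.P (expProd X).1.1 k k = Complex.exp (w.lam k (x - endOf B u x)) ∧
      conjHom w.P (expProd X).2.1 k k = Complex.exp (w.lam k (-(endOf B u x + x))) := by
  obtain ⟨x, p, hp, q, hq, rfl⟩ := (mem_gr B u).1 hX
  obtain ⟨h1, h2⟩ := w.conj_exp_add_nPos b (x - endOf B u x) hp
  obtain ⟨h3, h4⟩ := w.conj_exp_add_nNeg b (-(endOf B u x + x)) hq
  exact ⟨⟨h1, h3⟩, x, fun k => ⟨h2 k, h4 k⟩⟩

/-- Diagonal entries are multiplicative on triangular pairs, so the shape of the diagonal passes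
from generators to products and inverses. -/
theorem analyticSubgroup_gr {p : GL (Fin N) ℂ × GL (Fin N) ℂ}
    (hp : p ∈ analyticSubgroup (gr b B u)) : p ∈ w.triangular b ∧
    ∃ x : h, ∀ k, conjHom w.P p.1.1 k k = Complex.exp (w.lam k (x - endOf B u x)) ∧
      conjHom w.P p.2.1 k k = Complex.exp (w.lam k (-(endOf B u x + x))) := by
  induction hp using Subgroup.closure_induction with
  | mem p hp =>
    obtain ⟨X, hX, rfl⟩ := hp
    exact w.expProd_gr B u b hX
  | one => exact ⟨one_mem _, 0, by simp⟩
  | mul p q _ _ hp hq =>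
    obtain ⟨hp, x, hx⟩ := hp
    obtain ⟨hq, y, hy⟩ := hq
    refine ⟨mul_mem hp hq, x + y, fun k => ?_⟩
    rw [(triangular_mul_diag hp hq k).1, (triangular_mul_diag hp hq k).2, (hx k).1, (hx k).2,
      (hy k).1, (hy k).2, ← Complex.exp_add, ← Complex.exp_add]
    simp only [map_sub, map_add, map_neg]
    constructor <;> congr 1 <;> ring
  | inv p _ hp =>
    obtain ⟨hp, x, hx⟩ := hp
    refine ⟨inv_mem hp, -x, fun k => ?_⟩
    have h1 := triangular_mul_diag hp (inv_mem hp) k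
    rw [mul_inv_cancel, (hx k).1, (hx k).2] at h1
    simp only [Prod.fst_one, Prod.snd_one, Units.val_one, map_one, Matrix.one_apply_eq] at h1
    have h2 : -x - endOf B u (-x) = -(x - endOf B u x) := by rw [map_neg]; abel
    have h3 : -(endOf B u (-x) + -x) = -(-(endOf B u x + x)) := by rw [map_neg]; abel
    rw [h2, h3, map_neg (w.lam k) (x - _), map_neg (w.lam k) (-(_ + x)), Complex.exp_neg,
      Complex.exp_neg]
    exact ⟨(inv_eq_of_mul_eq_one_right h1.1.symm).symm, (inv_eq_of_mul_eq_one_right h1.2.symm).symm⟩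

end WeightFrame

theorem Gam_eq (b : (roots h).Base) {G : Subgroup (GL (Fin N) ℂ)} (hg : IsLieAlgebraOf g G) :
    Gam B u = diagSubgroup G ⊓ analyticSubgroup (gr b B u) := by
  obtain ⟨w⟩ := exists_weightFrame b
  ext p
  rw [mem_Gam, Subgroup.mem_inf]
  constructor
  · rintro ⟨x, rfl, hx⟩
    refine ⟨⟨expCartan (x - endOf B u x), ?_, ?_⟩, ?_⟩
    · have h1 := (hg _).1 ((x - endOf B u x : h) : g).2 1
      rwa [one_smul] at h1
    · exact Prod.ext rfl hx
    · exact Subgroup.subset_closure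
        ⟨theta B u x, theta_mem_gr B u b x, expProd_theta B u x⟩
  · rintro ⟨⟨γ, -, rfl⟩, hp⟩
    obtain ⟨⟨h1, h2⟩, x, hx⟩ := w.analyticSubgroup_gr B u b hp
    -- The same matrix `γ` is upper triangular as first component and lower triangular as second, so
    -- it is determined by its diagonal.
    have h3 : ∀ d : Fin N → ℂ, (∀ k, conjHom w.P γ.1 k k = d k) →
        conjHom w.P γ.1 = Matrix.diagonal d := by
      intro d hd
      ext k l
      by_cases hkl : k = l
      · subst hkl
        rw [Matrix.diagonal_apply_eq, hd]
      · rw [Matrix.diagonal_apply_ne _ hkl]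
        rcases lt_or_gt_of_ne (fun h => hkl (w.order_injective b h)) with h | h
        · exact h2 (OrderDual.toDual_lt_toDual.2 h)
        · exact h1 h
    have h4 := w.eq_expCartan (h3 _ fun k => (hx k).1)
    have h5 := w.eq_expCartan (h3 _ fun k => (hx k).2)
    exact ⟨x, Prod.ext h4 h5, h4.symm.trans h5⟩

end Groups

/-! ### Rationality of `u`: conditions (ii) and (iii). -/

section Rationality

variable {L : Type*} [LieRing L] [LieAlgebra ℂ L] [FiniteDimensional ℂ L]
  [LieAlgebra.HasTrivialRadical ℂ L] {h : LieSubalgebra ℂ L} [h.IsCartanSubalgebra]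
  (b : (roots h).Base)

/-- `x` is a rational combination of the simple coroots. -/
def IsRatElt (x : h) : Prop :=
  ∃ c : b.support → ℚ, x = ∑ j, (c j : ℂ) • (roots h).coroot j

/-- `mu` takes rational values on the simple coroots. -/
def IsRatFun (mu : Dual ℂ h) : Prop := ∀ i : b.support, ∃ q : ℚ, mu ((roots h).coroot i) = q

/-- `u` maps the rational span of the coroots into itself. -/
def IsRatTensor (B : LinearMap.BilinForm ℂ L) (u : h ⊗[ℂ] h) : Prop :=
  ∀ i : b.support, IsRatElt b (endOf B u ((roots h).coroot i))

variable {b}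

theorem exists_rat_sum {ι : Type*} (s : Finset ι) {c d : ι → ℂ} (hc : ∀ i, ∃ q : ℚ, c i = q)
    (hd : ∀ i, ∃ q : ℚ, d i = q) : ∃ q : ℚ, ∑ i ∈ s, c i * d i = q := by
  choose p hp using hc
  choose q hq using hd
  exact ⟨∑ i ∈ s, p i * q i, by push_cast; simp only [hp, hq]⟩

theorem IsRatFun.apply {mu : Dual ℂ h} (hmu : IsRatFun b mu) {x : h} (hx : IsRatElt b x) :
    ∃ q : ℚ, mu x = q := by
  obtain ⟨c, rfl⟩ := hx
  simp only [map_sum, map_smul, smul_eq_mul]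
  exact exists_rat_sum _ (fun i => ⟨c i, rfl⟩) hmu

theorem eq_of_apply_coroot {mu nu : Dual ℂ h}
    (hmn : ∀ i : b.support, mu ((roots h).coroot i) = nu ((roots h).coroot i)) : mu = nu :=
  b.toCoweightBasis.ext fun i => by simpa using hmn i

theorem eq_zero_of_root_apply {x : h} (hx : ∀ i : b.support, (roots h).root i x = 0) : x = 0 := by
  refine (Module.forall_dual_apply_eq_zero_iff ℂ x).1 fun mu => ?_
  rw [← b.toWeightBasis.sum_repr mu]
  simp only [LinearMap.sum_apply, LinearMap.smul_apply, RootPairing.Base.toWeightBasis_apply, hx,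
    smul_zero, Finset.sum_const_zero]

theorem isRatElt_of_apply {ι : Type*} (f : ι → Dual ℂ h) (hf : ∀ x, (∀ k, f k x = 0) → x = 0)
    (hfr : ∀ k, IsRatFun b (f k)) {x : h} (hx : ∀ k, ∃ q : ℚ, f k x = q) : IsRatElt b x := by
  refine exists_rat_combination (fun j : b.support => (roots h).coroot j) f hf
    (fun k i => hfr k i) ?_ hx
  have h1 := b.toCoweightBasis.mem_span x
  rwa [show (⇑b.toCoweightBasis : b.support → h) = fun j : b.support => (roots h).coroot j from
    funext fun j => b.toCoweightBasis_apply j] at h1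

theorem IsRatFun.exists_combination {ι : Type*} [Fintype ι] (f : ι → Dual ℂ h)
    (hf : Submodule.span ℂ (Set.range f) = ⊤) (hfr : ∀ k, IsRatFun b (f k)) {mu : Dual ℂ h}
    (hmu : IsRatFun b mu) : ∃ c : ι → ℚ, mu = ∑ k, (c k : ℂ) • f k :=
  exists_rat_combination f (fun i : b.support => Dual.eval ℂ h ((roots h).coroot i))
    (fun _ hw => eq_of_apply_coroot (b := b) fun i => hw i) (fun i k => hfr k i)
    (hf ▸ Submodule.mem_top) hmu

theorem isRatFun_of_mem_weightLattice {mu : Dual ℂ h} (hmu : mu ∈ weightLattice h) :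
    IsRatFun b mu := fun i => by
  obtain ⟨z, hz⟩ := hmu i
  exact ⟨z, by rw [hz]; simp⟩

theorem root_mem_weightLattice (i : h.root) : (roots h).root i ∈ weightLattice h := fun j =>
  ⟨(roots h).pairingIn ℤ i j, by
    have := (roots h).algebraMap_pairingIn ℤ i j
    rw [← RootPairing.root_coroot_eq_pairing] at this
    exact this.symm⟩

theorem span_root_eq_top :
    Submodule.span ℂ (Set.range fun i : b.support => (roots h).root i) = ⊤ := by
  have h1 := b.toWeightBasis.span_eq
  rwa [show (⇑b.toWeightBasis : b.support → Dual ℂ h) = fun j : b.support => (roots h).root j from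
    funext fun j => b.toWeightBasis_apply j] at h1

section Form

variable {B : LinearMap.BilinForm ℂ L} (u : h ⊗[ℂ] h)

theorem apply_endOf (hB : B.IsSymm) (mu : Dual ℂ h) (x : h) :
    mu (endOf B u x) = formOf u (pairingMap B x) mu := by
  induction u using TensorProduct.induction_on with
  | zero => simp [endOf, formOf]
  | tmul a c =>
    rw [endOf_tmul, formOf_tmul, map_smul, smul_eq_mul, ← hB.eq]
    rfl
  | add a c ha hc =>
    simp only [endOf, formOf, map_add, LinearMap.add_apply] at ha hc ⊢
    rw [ha, hc]

theorem formOf_sum_smul {ι : Type*} (s : Finset ι) (c : ι → ℂ) (f : ι → Dual ℂ h)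
    (mu : Dual ℂ h) : formOf u (∑ i ∈ s, c i • f i) mu = ∑ i ∈ s, c i * formOf u (f i) mu := by
  simp only [formOf, TensorProduct.sum_tmul, ← TensorProduct.smul_tmul', map_sum, map_smul,
    LinearMap.sum_apply, LinearMap.smul_apply, smul_eq_mul]

/-- The normalisation says that `t i` and `d i • h i` agree under all simple roots, so `B`
identifies `α i` with `d i • h i`. -/
theorem IsNormalizedForm.apply_endOf_coroot {d : b.support → ℕ} (hB : IsNormalizedForm b d B)
    (mu : Dual ℂ h) (i : b.support) :
    d i * mu (endOf B u ((roots h).coroot i)) = formOf u ((roots h).root i) mu := by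
  obtain ⟨t, ht, htt⟩ := hB.normalized
  have h1 : (d i : ℂ) • (roots h).coroot i = t i := by
    refine sub_eq_zero.1 (eq_zero_of_root_apply (b := b) fun j => ?_)
    rw [map_sub, map_smul, smul_eq_mul, ← htt, ← ht j (t i), hB.symm.eq, sub_self]
  have h2 : pairingMap B (t i) = (roots h).root i := by
    ext x
    rw [← ht i x, hB.symm.eq]
    rfl
  rw [← h2, ← apply_endOf u hB.symm, ← h1, map_smul, map_smul, smul_eq_mul]

variable {d : b.support → ℕ} (hB : IsNormalizedForm b d B)
include hB

/-- Simple roots are weights, and every weight is a rational combination of them, so the first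
argument of the form may be taken to be a simple root. -/
theorem IsNormalizedForm.isRatTensor_iff_formOf : IsRatTensor b B u ↔
    ∀ lam ∈ weightLattice h, ∀ mu ∈ weightLattice h, ∃ q : ℚ, formOf u lam mu = q := by
  constructor
  · intro hu lam hlam mu hmu
    obtain ⟨c, rfl⟩ := (isRatFun_of_mem_weightLattice (b := b) hlam).exists_combination _
      (span_root_eq_top (b := b)) fun k => isRatFun_of_mem_weightLattice (root_mem_weightLattice _)
    rw [formOf_sum_smul]
    refine exists_rat_sum _ (fun i => ⟨c i, rfl⟩) fun i => ?_
    obtain ⟨q, hq⟩ := (isRatFun_of_mem_weightLattice (b := b) hmu).apply (hu i)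
    exact ⟨d i * q, by rw [← hB.apply_endOf_coroot, hq]; simp⟩
  · intro hu i
    refine isRatElt_of_apply (fun j : b.support => (roots h).root j)
      (fun x => eq_zero_of_root_apply)
      (fun k => isRatFun_of_mem_weightLattice (root_mem_weightLattice _)) fun j => ?_
    obtain ⟨q, hq⟩ := hu _ (root_mem_weightLattice i) _ (root_mem_weightLattice j)
    have hd : (d i : ℂ) ≠ 0 := by exact_mod_cast (hB.pos i).ne'
    rw [← hB.apply_endOf_coroot] at hq
    exact ⟨q / d i, by push_cast; rw [← hq, mul_div_cancel_left₀ _ hd]⟩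

end Form

theorem isRatTensor_iff_Phi {B : LinearMap.BilinForm ℂ L} {u : h ⊗[ℂ] h} : IsRatTensor b B u ↔
    ∃ m : ℕ, 0 < m ∧ ∀ lam ∈ weightLattice h, Phi B u (m • lam) ∈ weightLattice h := by
  have hPhi : ∀ (m : ℕ) (lam : Dual ℂ h) (x : h),
      Phi B u (m • lam) x = -(m * lam (endOf B u x)) := by
    intro m lam x
    rw [Phi, map_nsmul]
    simp
  constructor
  · intro hu
    choose c hc using hu
    obtain ⟨m, hm, hmc⟩ := exists_common_denominator fun p : b.support × b.support => c p.1 p.2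
    choose z hz using hmc
    refine ⟨m, hm, fun lam hlam i => ?_⟩
    choose y hy using hlam
    simp only [hPhi]
    -- Membership in the weight lattice tests all coroots; each is an integral combination of simple
    -- ones.
    suffices h1 : ∀ x ∈ Submodule.span ℤ ((roots h).coroot '' b.support),
        ∃ y : ℤ, m * lam (endOf B u x) = y by
      obtain ⟨y, hy⟩ := h1 _ (b.coroot_mem_span_int i)
      exact ⟨-y, by rw [hy]; simp⟩
    intro x hx
    induction hx using Submodule.span_induction with
    | mem x hx =>
      obtain ⟨j, hj, rfl⟩ := hx
      refine ⟨∑ k, z (⟨j, hj⟩, k) * y k, ?_⟩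
      rw [hc ⟨j, hj⟩, map_sum, Finset.mul_sum]
      push_cast
      refine Finset.sum_congr rfl fun k _ => ?_
      have h2 : ((m : ℂ) * (c ⟨j, hj⟩ k : ℂ)) = (z (⟨j, hj⟩, k) : ℂ) := by
        exact_mod_cast congrArg (fun q : ℚ => (q : ℂ)) (hz (⟨j, hj⟩, k))
      rw [map_smul, smul_eq_mul, hy, ← mul_assoc, h2]
    | zero => exact ⟨0, by simp⟩
    | add x x' _ _ hx hx' =>
      obtain ⟨y, hy⟩ := hx
      obtain ⟨y', hy'⟩ := hx'
      exact ⟨y + y', by rw [map_add, map_add, mul_add, hy, hy']; simp⟩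
    | smul n x _ hx =>
      obtain ⟨y, hy⟩ := hx
      refine ⟨n * y, ?_⟩
      rw [map_zsmul, map_zsmul, zsmul_eq_mul]
      push_cast
      rw [← hy]
      ring
  · rintro ⟨m, hm, hu⟩ i
    refine isRatElt_of_apply (fun j : b.support => (roots h).root j)
      (fun x => eq_zero_of_root_apply)
      (fun k => isRatFun_of_mem_weightLattice (root_mem_weightLattice _)) fun j => ?_
    obtain ⟨z, hz⟩ := hu _ (root_mem_weightLattice j) i
    have hm' : (m : ℂ) ≠ 0 := by exact_mod_cast hm.ne'
    rw [hPhi] at hz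
    refine ⟨-z / m, ?_⟩
    push_cast
    rw [eq_div_iff hm', ← hz]
    ring

end Rationality

/-! ### Finiteness of `Γ`: condition (iv). -/

section Finite

variable {N : ℕ} {g : LieSubalgebra ℂ (Matrix (Fin N) (Fin N) ℂ)} [LieAlgebra.HasTrivialRadical ℂ g]
  {h : LieSubalgebra ℂ g} [h.IsCartanSubalgebra] {b : (roots h).Base} (w : WeightFrame h)
  {B : LinearMap.BilinForm ℂ g} {u : h ⊗[ℂ] h}

theorem WeightFrame.isRatFun (k : Fin N) : IsRatFun b (w.lam k) :=
  isRatFun_of_mem_weightLattice (w.integral k)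

theorem IsRatTensor.isRatFun_comp (hu : IsRatTensor b B u) {mu : Dual ℂ h} (hmu : IsRatFun b mu) :
    IsRatFun b (mu ∘ₗ endOf B u) := fun i => hmu.apply (hu i)

/-- Up to a common denominator, composition with `u` preserves the lattice spanned by the
weights. -/
theorem IsRatTensor.exists_int_combination (hu : IsRatTensor b B u) :
    ∃ (q : ℕ) (m : Fin N → Fin N → ℤ), 0 < q ∧
      ∀ k x, q * w.lam k (endOf B u x) = ∑ j, m k j * w.lam j x := by
  have h1 : ∀ k, ∃ c : Fin N → ℚ, w.lam k ∘ₗ endOf B u = ∑ j, (c j : ℂ) • w.lam j := fun k =>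
    (hu.isRatFun_comp (w.isRatFun k)).exists_combination _ w.span_lam w.isRatFun
  choose c hc using h1
  obtain ⟨q, hq, hqc⟩ := exists_common_denominator fun p : Fin N × Fin N => c p.1 p.2
  choose z hz using hqc
  refine ⟨q, fun k j => z (k, j), hq, fun k x => ?_⟩
  have h2 := LinearMap.congr_fun (hc k) x
  rw [LinearMap.comp_apply] at h2
  rw [h2, LinearMap.sum_apply, Finset.mul_sum]
  refine Finset.sum_congr rfl fun j _ => ?_
  have h3 : ((q : ℂ) * (c k j : ℂ)) = (z (k, j) : ℂ) := by
    exact_mod_cast congrArg (fun q : ℚ => (q : ℂ)) (hz (k, j))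
  rw [LinearMap.smul_apply, smul_eq_mul, ← mul_assoc, h3]

theorem IsRatTensor.of_finite (b : (roots h).Base)
    (hfin : (Gam B u : Set (GL (Fin N) ℂ × GL (Fin N) ℂ)).Finite) : IsRatTensor b B u := by
  obtain ⟨w⟩ := exists_weightFrame b
  intro i
  refine isRatElt_of_apply w.lam (fun x => w.eq_zero_of_lam) w.isRatFun fun k => ?_
  set y := endOf B u ((roots h).coroot i) with hy
  -- Weights are integral on the coroot, so `exp(2x) = 1` and `x` defines a point of `Γ`.
  let x : h := (Real.pi * Complex.I : ℂ) • (roots h).coroot i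
  have hux : endOf B u x = (Real.pi * Complex.I : ℂ) • y := map_smul _ _ _
  have hx : expCartan (x - endOf B u x) = expCartan (-(endOf B u x + x)) := by
    refine w.expCartan_eq fun k => ?_
    obtain ⟨z, hz⟩ := w.integral k i
    rw [Complex.exp_eq_exp_iff_exists_int]
    refine ⟨z, ?_⟩
    simp only [map_sub, map_neg, map_add, x, map_smul, hz, smul_eq_mul]
    ring
  let γ : Gam B u := ⟨_, (mem_Gam B u).2 ⟨x, rfl, hx⟩⟩
  have : Finite (Gam B u) := hfin.to_subtype
  obtain ⟨n, hn, hγ⟩ := (isOfFinOrder_iff_pow_eq_one.1 (isOfFinOrder_of_finite γ))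
  have h1 : expCartan (n • (x - endOf B u x)) = expCartan (0 : h) := by
    rw [expCartan_nsmul, expCartan_zero]
    exact congrArg (fun p : Gam B u => (p : GL (Fin N) ℂ × GL (Fin N) ℂ).1) hγ
  have h2 := w.exp_lam_eq h1 k
  obtain ⟨z, hz⟩ := w.integral k i
  rw [Complex.exp_eq_exp_iff_exists_int] at h2
  obtain ⟨z', hz'⟩ := h2
  have hn' : (n : ℂ) ≠ 0 := by exact_mod_cast hn.ne'
  have hpi : (Real.pi * Complex.I : ℂ) ≠ 0 :=
    mul_ne_zero (by exact_mod_cast Real.pi_ne_zero) Complex.I_ne_zero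
  -- With `n` the exponent that kills this point, `n πi (z - λ_k(y)) = 2πi z'`.
  refine ⟨z - 2 * z' / n, ?_⟩
  rw [map_nsmul, map_sub, hux, map_smul, map_smul, hz, map_zero, nsmul_eq_mul, smul_eq_mul,
    smul_eq_mul] at hz'
  push_cast
  field_simp
  refine mul_left_cancel₀ hpi ?_
  linear_combination -hz'

/-- On `Γ` one has `λ_k(x) ∈ πiℤ`, so `2q λ_k(x - ux) ∈ 2πiℤ` for the common denominator `q`. The
diagonal entries are thus `2q`-th roots of unity, and those of the first component determine the
point. -/
theorem IsRatTensor.finite (hu : IsRatTensor b B u) :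
    (Gam B u : Set (GL (Fin N) ℂ × GL (Fin N) ℂ)).Finite := by
  obtain ⟨w⟩ := exists_weightFrame b
  obtain ⟨q, m, hq, hm⟩ := hu.exists_int_combination w
  let F : GL (Fin N) ℂ × GL (Fin N) ℂ → Fin N → ℂ := fun p k => conjHom w.P p.1.1 k k
  have hF : ∀ x : h, F (expCartan (x - endOf B u x), expCartan (-(endOf B u x + x))) =
      fun k => Complex.exp (w.lam k (x - endOf B u x)) := by
    intro x
    ext k
    simp only [F]
    rw [w.conj_expCartan, Matrix.diagonal_apply_eq]
  have hroots : {z : ℂ | z ^ (2 * q) = 1}.Finite :=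
    (Polynomial.nthRootsFinset (2 * q) (1 : ℂ)).finite_toSet.subset fun z hz =>
      (Polynomial.mem_nthRootsFinset (by omega) 1).2 hz
  refine Set.Finite.of_finite_image (f := F)
    ((Set.Finite.pi' (fun _ : Fin N => hroots)).subset ?_) ?_
  · rintro _ ⟨p, hp, rfl⟩ k
    obtain ⟨x, rfl, hx⟩ := (mem_Gam B u).1 hp
    rw [hF]
    have h1 : ∀ k, ∃ z : ℤ, w.lam k x = z * (Real.pi * Complex.I) := by
      intro k
      have h2 := w.exp_lam_eq hx k
      rw [Complex.exp_eq_exp_iff_exists_int] at h2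
      obtain ⟨z, hz⟩ := h2
      rw [map_neg, map_sub, map_add] at hz
      exact ⟨z, by linear_combination hz / 2⟩
    choose z hz using h1
    rw [Set.mem_ofPred_eq, ← Complex.exp_nat_mul, Complex.exp_eq_one_iff]
    refine ⟨q * z k - ∑ j, m k j * z j, ?_⟩
    have h3 := hm k x
    simp only [hz, ← mul_assoc] at h3
    rw [← Finset.sum_mul, ← Finset.sum_mul] at h3
    rw [map_sub, hz]
    push_cast
    linear_combination (-2) * h3
  · rintro p hp p' hp' hpp
    obtain ⟨x, rfl, hx⟩ := (mem_Gam B u).1 hp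
    obtain ⟨x', rfl, hx'⟩ := (mem_Gam B u).1 hp'
    rw [hF, hF] at hpp
    have h1 := w.expCartan_eq fun k => congrFun hpp k
    exact Prod.ext h1 (hx.symm.trans (h1.trans hx'))

end Finite

/-! ### Zariski closed sets and regular functions. -/

section Zariski

variable {X Y σ τ : Type*} {coord : X → σ → ℂ}

theorem IsZariskiClosed.inter {S T : Set X} (hS : IsZariskiClosed coord S)
    (hT : IsZariskiClosed coord T) : IsZariskiClosed coord (S ∩ T) := by
  obtain ⟨I, rfl⟩ := hS
  obtain ⟨J, rfl⟩ := hT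
  refine ⟨I ∪ J, ?_⟩
  ext x
  simp only [Set.mem_inter_iff, Set.mem_ofPred_eq, Set.mem_union, or_imp, forall_and]

theorem isZariskiClosed_iInter {ι : Sort*} {S : ι → Set X}
    (hS : ∀ i, IsZariskiClosed coord (S i)) : IsZariskiClosed coord (⋂ i, S i) := by
  choose I hI using hS
  refine ⟨⋃ i, I i, ?_⟩
  ext x
  simp only [hI, Set.mem_iInter, Set.mem_ofPred_eq, Set.mem_iUnion, forall_exists_index]
  exact forall_comm

/-- The functions on `X` which are polynomials in the coordinates. -/
def IsRegular (coord : X → σ → ℂ) (f : X → ℂ) : Prop :=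
  ∃ p : MvPolynomial σ ℂ, ∀ x, MvPolynomial.eval (coord x) p = f x

theorem isRegular_coord (s : σ) : IsRegular coord fun x => coord x s :=
  ⟨MvPolynomial.X s, fun x => by simp⟩

theorem isRegular_const (c : ℂ) : IsRegular coord fun _ => c := ⟨MvPolynomial.C c, fun x => by simp⟩

theorem IsRegular.mul {f f' : X → ℂ} (hf : IsRegular coord f) (hf' : IsRegular coord f') :
    IsRegular coord fun x => f x * f' x := by
  obtain ⟨p, hp⟩ := hf
  obtain ⟨q, hq⟩ := hf'
  exact ⟨p * q, fun x => by rw [map_mul, hp, hq]⟩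

theorem IsRegular.pow {f : X → ℂ} (hf : IsRegular coord f) (n : ℕ) :
    IsRegular coord fun x => f x ^ n := by
  obtain ⟨p, hp⟩ := hf
  exact ⟨p ^ n, fun x => by rw [map_pow, hp]⟩

theorem isRegular_sum {ι : Type*} {s : Finset ι} {f : ι → X → ℂ}
    (hf : ∀ i, IsRegular coord (f i)) : IsRegular coord fun x => ∑ i ∈ s, f i x := by
  choose p hp using hf
  exact ⟨∑ i ∈ s, p i, fun x => by simp only [map_sum, hp]⟩

theorem isRegular_prod {ι : Type*} {s : Finset ι} {f : ι → X → ℂ}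
    (hf : ∀ i, IsRegular coord (f i)) : IsRegular coord fun x => ∏ i ∈ s, f i x := by
  choose p hp using hf
  exact ⟨∏ i ∈ s, p i, fun x => by simp only [map_prod, hp]⟩

theorem IsRegular.isZariskiClosed_eq {f f' : X → ℂ} (hf : IsRegular coord f)
    (hf' : IsRegular coord f') : IsZariskiClosed coord {x | f x = f' x} := by
  obtain ⟨p, hp⟩ := hf
  obtain ⟨q, hq⟩ := hf'
  refine ⟨{p - q}, ?_⟩
  ext x
  simp only [Set.mem_ofPred_eq, Set.mem_singleton_iff, forall_eq, map_sub, hp, hq, sub_eq_zero]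

theorem IsZariskiClosed.preimage {coord' : Y → τ → ℂ} {S : Set Y} (hS : IsZariskiClosed coord' S)
    (F : X → Y) (e : τ → σ) (he : ∀ x t, coord' (F x) t = coord x (e t)) :
    IsZariskiClosed coord (F ⁻¹' S) := by
  obtain ⟨I, rfl⟩ := hS
  refine ⟨MvPolynomial.rename e '' I, ?_⟩
  ext x
  simp only [Set.mem_preimage, Set.mem_ofPred_eq, Set.forall_mem_image, MvPolynomial.eval_rename]
  rw [show coord' (F x) = coord x ∘ e from funext (he x)]

end Zariski

/-! ### Algebraicity of `𝔤_r`: condition (i). -/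

section Algebraic

variable {N : ℕ} {g : LieSubalgebra ℂ (Matrix (Fin N) (Fin N) ℂ)} [LieAlgebra.HasTrivialRadical ℂ g]
  {h : LieSubalgebra ℂ g} [h.IsCartanSubalgebra] {b : (roots h).Base}
  {B : LinearMap.BilinForm ℂ g} {u : h ⊗[ℂ] h} {G : Subgroup (GL (Fin N) ℂ)}

theorem isRegular_conj_fst (P : GL (Fin N) ℂ) (k l : Fin N) :
    IsRegular glProdCoord fun p => conjHom P p.1.1 k l := by
  simp only [conjHom_apply, Matrix.mul_apply]
  exact isRegular_sum fun i => (isRegular_sum fun j => (isRegular_const _).mul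
    (isRegular_coord (Sum.inl (j, i)))).mul (isRegular_const _)

theorem isRegular_conj_snd (P : GL (Fin N) ℂ) (k l : Fin N) :
    IsRegular glProdCoord fun p => conjHom P p.2.1 k l := by
  simp only [conjHom_apply, Matrix.mul_apply]
  exact isRegular_sum fun i => (isRegular_sum fun j => (isRegular_const _).mul
    (isRegular_coord (Sum.inr (j, i)))).mul (isRegular_const _)

theorem isZariskiClosed_prod (hG : IsZariskiClosed glCoord (G : Set (GL (Fin N) ℂ))) :
    IsZariskiClosed glProdCoord (G.prod G : Set (GL (Fin N) ℂ × GL (Fin N) ℂ)) :=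
  (hG.preimage Prod.fst Sum.inl fun _ _ => rfl).inter
    (hG.preimage Prod.snd Sum.inr fun _ _ => rfl)

namespace WeightFrame

variable (w : WeightFrame h)

theorem isZariskiClosed_triangular (b : (roots h).Base) : IsZariskiClosed glProdCoord
    (w.triangular b : Set (GL (Fin N) ℂ × GL (Fin N) ℂ)) := by
  have h1 : (w.triangular b : Set (GL (Fin N) ℂ × GL (Fin N) ℂ)) =
      (⋂ (k) (l) (_ : w.order b l < w.order b k), {p | conjHom w.P p.1.1 k l = 0}) ∩
      (⋂ (k) (l) (_ : w.order b k < w.order b l), {p | conjHom w.P p.2.1 k l = 0}) := by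
    ext p
    simp only [Set.mem_inter_iff, Set.mem_iInter, Set.mem_ofPred_eq]
    exact Iff.rfl
  rw [h1]
  exact (isZariskiClosed_iInter fun k => isZariskiClosed_iInter fun l =>
      isZariskiClosed_iInter fun _ => (isRegular_conj_fst w.P k l).isZariskiClosed_eq
        (isRegular_const 0)).inter
    (isZariskiClosed_iInter fun k => isZariskiClosed_iInter fun l =>
      isZariskiClosed_iInter fun _ => (isRegular_conj_snd w.P k l).isZariskiClosed_eq
        (isRegular_const 0))

/-- A monomial in the diagonal entries of a pair of triangular matrices. -/
def monomial (e : (Fin N → ℕ) × (Fin N → ℕ)) (p : GL (Fin N) ℂ × GL (Fin N) ℂ) : ℂ :=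
  (∏ k, conjHom w.P p.1.1 k k ^ e.1 k) * ∏ k, conjHom w.P p.2.1 k k ^ e.2 k

theorem isRegular_monomial (e : (Fin N → ℕ) × (Fin N → ℕ)) :
    IsRegular glProdCoord (w.monomial e) :=
  (isRegular_prod fun k => (isRegular_conj_fst w.P k k).pow _).mul
    (isRegular_prod fun k => (isRegular_conj_snd w.P k k).pow _)

theorem monomial_mul (e : (Fin N → ℕ) × (Fin N → ℕ)) {p q : GL (Fin N) ℂ × GL (Fin N) ℂ}
    (hp : p ∈ w.triangular b) (hq : q ∈ w.triangular b) :
    w.monomial e (p * q) = w.monomial e p * w.monomial e q := by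
  simp only [monomial, (triangular_mul_diag hp hq _).1, (triangular_mul_diag hp hq _).2, mul_pow,
    Finset.prod_mul_distrib]
  ring

theorem monomial_one (e : (Fin N → ℕ) × (Fin N → ℕ)) : w.monomial e 1 = 1 := by
  simp [monomial]

theorem monomial_of_diag (e : (Fin N → ℕ) × (Fin N → ℕ)) {p : GL (Fin N) ℂ × GL (Fin N) ℂ}
    {x y : Fin N → ℂ} (hx : ∀ k, conjHom w.P p.1.1 k k = Complex.exp (x k))
    (hy : ∀ k, conjHom w.P p.2.1 k k = Complex.exp (y k)) :
    w.monomial e p = Complex.exp (∑ k, e.1 k * x k + ∑ k, e.2 k * y k) := by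
  simp only [monomial, hx, hy, Complex.exp_add, Complex.exp_sum, Complex.exp_nat_mul]

/-- The pairs of triangular matrices whose diagonal entries satisfy monomial relations. -/
def monomialSubgroup (b : (roots h).Base) {ι : Type*}
    (e f : ι → (Fin N → ℕ) × (Fin N → ℕ)) : Subgroup (GL (Fin N) ℂ × GL (Fin N) ℂ) where
  carrier := {p | p ∈ w.triangular b ∧ ∀ i, w.monomial (e i) p = w.monomial (f i) p}
  one_mem' := ⟨one_mem _, fun i => by rw [monomial_one, monomial_one]⟩
  mul_mem' := by
    rintro p q ⟨hp, hp'⟩ ⟨hq, hq'⟩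
    exact ⟨mul_mem hp hq, fun i => by
      rw [w.monomial_mul _ hp hq, w.monomial_mul _ hp hq, hp', hq']⟩
  inv_mem' := by
    rintro p ⟨hp, hp'⟩
    have h1 : ∀ e, w.monomial e p⁻¹ = (w.monomial e p)⁻¹ := fun e => by
      refine eq_inv_of_mul_eq_one_left ?_
      rw [← w.monomial_mul e (inv_mem hp) hp, inv_mul_cancel, w.monomial_one]
    exact ⟨inv_mem hp, fun i => by rw [h1, h1, hp']⟩

theorem isZariskiClosed_monomialSubgroup {ι : Type*} (e f : ι → (Fin N → ℕ) × (Fin N → ℕ)) :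
    IsZariskiClosed glProdCoord
      (w.monomialSubgroup b e f : Set (GL (Fin N) ℂ × GL (Fin N) ℂ)) := by
  have h1 : (w.monomialSubgroup b e f : Set (GL (Fin N) ℂ × GL (Fin N) ℂ)) =
      (w.triangular b : Set (GL (Fin N) ℂ × GL (Fin N) ℂ)) ∩
        ⋂ i, {p | w.monomial (e i) p = w.monomial (f i) p} := by
    ext p
    simp only [Set.mem_inter_iff, Set.mem_iInter, Set.mem_ofPred_eq]
    exact Iff.rfl
  rw [h1]
  exact (w.isZariskiClosed_triangular b).inter (isZariskiClosed_iInter fun i =>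
    (w.isRegular_monomial _).isZariskiClosed_eq (w.isRegular_monomial _))

/-- The elements of `g × g` whose one-parameter groups are triangular. -/
theorem exists_borel_of_exp_triangular {X : g × g}
    (hX : ∀ t : ℂ, expProd (t • X) ∈ w.triangular b) : ∃ a a' : h, ∃ p ∈ nPos b, ∃ q ∈ nNeg b,
      X = ((a : g) + p, (a' : g) + q) := by
  have hc : ∀ (M : Matrix (Fin N) (Fin N) ℂ) (k l : Fin N),
      (∀ t : ℂ, conjHom w.P (expGL (t • M)).1 k l = 0) → conjHom w.P M k l = 0 := by
    intro M k l hM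
    refine apply_eq_zero_of_exp_smul fun t => ?_
    rw [← map_smul, ← conjHom_exp]
    exact hM t
  obtain ⟨a, p, hp, q, hq, h1⟩ := exists_triangular_decomposition b X.1
  obtain ⟨a', p', hp', q', hq', h2⟩ := exists_triangular_decomposition b X.2
  -- The `n⁻` part is strictly lower triangular, while differentiating the one-parameter group makes
  -- the whole component upper triangular.
  have hq0 : q = 0 := by
    refine Subtype.ext (conjHom_injective w.P ?_)
    rw [ZeroMemClass.coe_zero, map_zero]
    ext k l
    rcases le_or_gt (w.order b k) (w.order b l) with hkl | hkl
    · exact w.conj_nNeg_apply b hq hkl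
    · have h3 := hc _ k l fun t => (hX t).1 hkl
      rw [h1, AddMemClass.coe_add, map_add, Matrix.add_apply,
        (w.conj_add_nPos b a hp).1 hkl, zero_add] at h3
      exact h3
  have hp0 : p' = 0 := by
    refine Subtype.ext (conjHom_injective w.P ?_)
    rw [ZeroMemClass.coe_zero, map_zero]
    ext k l
    rcases le_or_gt (w.order b l) (w.order b k) with hkl | hkl
    · exact w.conj_nPos_apply b hp' hkl
    · have h3 := hc _ k l fun t => (hX t).2 (OrderDual.toDual_lt_toDual.2 hkl)
      rw [h2, add_right_comm, AddMemClass.coe_add, map_add, Matrix.add_apply,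
        (w.conj_add_nNeg b a' hq').1 (OrderDual.toDual_lt_toDual.2 hkl), zero_add] at h3
      exact h3
  refine ⟨a, a', p, hp, q', hq', Prod.ext ?_ ?_⟩
  · rw [h1, hq0, add_zero]
  · rw [h2, hp0, add_zero]

end WeightFrame

/-- A pair `(a, a')` lies in `𝔞` exactly when `u(a - a') + (a + a') = 0`. Applying `q λ_k` turns
this into relations with integral coefficients between the `λ_j(a)` and `λ_j(a')`, whose
exponentials are monomial equations. -/
theorem IsRatTensor.isAlgebraicLie (hu : IsRatTensor b B u)
    (hG : IsZariskiClosed glCoord (G : Set (GL (Fin N) ℂ))) (hg : IsLieAlgebraOf g G) :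
    IsAlgebraicLie G (gr b B u) := by
  obtain ⟨w⟩ := exists_weightFrame b
  obtain ⟨q, m, hq, hm⟩ := hu.exists_int_combination w
  -- Negative powers are moved to the other side of the equation, so both exponents are natural
  -- numbers.
  let e : Fin N → (Fin N → ℕ) × (Fin N → ℕ) := fun k =>
    (fun j => (m k j).toNat + if j = k then q else 0,
      fun j => (-m k j).toNat + if j = k then q else 0)
  let f : Fin N → (Fin N → ℕ) × (Fin N → ℕ) := fun k =>
    (fun j => (-m k j).toNat, fun j => (m k j).toNat)
  have hef : ∀ k (x y : Fin N → ℂ), (∑ j, (e k).1 j * x j + ∑ j, (e k).2 j * y j) -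
      (∑ j, (f k).1 j * x j + ∑ j, (f k).2 j * y j) =
      ∑ j, m k j * (x j - y j) + q * (x k + y k) := by
    intro k x y
    have h1 : (q : ℂ) * (x k + y k) = ∑ j, (if j = k then (q : ℂ) else 0) * (x j + y j) := by
      simp
    rw [h1, ← Finset.sum_add_distrib, ← Finset.sum_add_distrib, ← Finset.sum_add_distrib,
      ← Finset.sum_sub_distrib]
    refine Finset.sum_congr rfl fun j _ => ?_
    have h2 : ((m k j : ℤ) : ℂ) = ((m k j).toNat : ℂ) - ((-m k j).toNat : ℂ) := by
      have := Int.toNat_sub_toNat_neg (m k j)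
      exact_mod_cast congrArg (fun z : ℤ => (z : ℂ)) this.symm
    simp only [e, f, h2]
    push_cast
    ring
  -- the linear form attached to the relation `k` vanishes on the image of `theta`
  have hrel : ∀ k (x : h), ∑ j, m k j * (w.lam j (x - endOf B u x) - w.lam j (-(endOf B u x + x))) +
      q * (w.lam k (x - endOf B u x) + w.lam k (-(endOf B u x + x))) = 0 := by
    intro k x
    have h1 := hm k x
    have h2 : ∑ j, m k j * (w.lam j (x - endOf B u x) - w.lam j (-(endOf B u x + x))) =
        2 * ∑ j, m k j * w.lam j x := by
      rw [Finset.mul_sum]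
      refine Finset.sum_congr rfl fun j _ => ?_
      rw [map_neg, map_sub, map_add]
      ring
    rw [h2, ← h1, map_neg, map_sub, map_add]
    ring
  refine ⟨G.prod G ⊓ w.monomialSubgroup b e f, inf_le_left,
    (isZariskiClosed_prod hG).inter (w.isZariskiClosed_monomialSubgroup e f), fun X => ?_⟩
  constructor
  · intro hX t
    refine ⟨⟨(hg _).1 X.1.2 t, (hg _).1 X.2.2 t⟩, ?_⟩
    obtain ⟨h1, x, hx⟩ := w.expProd_gr B u b ((gr b B u).smul_mem t hX)
    refine ⟨h1, fun k => ?_⟩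
    rw [w.monomial_of_diag _ (fun k => (hx k).1) (fun k => (hx k).2),
      w.monomial_of_diag _ (fun k => (hx k).1) (fun k => (hx k).2)]
    congr 1
    rw [← sub_eq_zero, hef, hrel]
  · intro hX
    obtain ⟨a, a', p, hp, r, hr, rfl⟩ := w.exists_borel_of_exp_triangular fun t => (hX t).2.1
    have h1 : ∀ (t : ℂ) k,
        conjHom w.P (expProd (t • (((a : g) + p, (a' : g) + r) : g × g))).1.1 k k =
          Complex.exp (t * w.lam k a) ∧
        conjHom w.P (expProd (t • (((a : g) + p, (a' : g) + r) : g × g))).2.1 k k =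
          Complex.exp (t * w.lam k a') := by
      intro t k
      have h2 := (w.conj_exp_add_nPos b (t • a) ((nPos b).smul_mem t hp)).2 k
      have h3 := (w.conj_exp_add_nNeg b (t • a') ((nNeg b).smul_mem t hr)).2 k
      rw [map_smul, smul_eq_mul, SetLike.val_smul, ← smul_add] at h2 h3
      exact ⟨h2, h3⟩
    have h2 : ∀ k, ∑ j, m k j * (w.lam j a - w.lam j a') + q * (w.lam k a + w.lam k a') = 0 := by
      intro k
      rw [← hef, sub_eq_zero]
      refine eq_of_forall_exp_eq fun t => ?_
      have h3 := (hX t).2.2 k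
      rw [w.monomial_of_diag _ (fun k => (h1 t k).1) (fun k => (h1 t k).2),
        w.monomial_of_diag _ (fun k => (h1 t k).1) (fun k => (h1 t k).2)] at h3
      simp only [mul_add, Finset.mul_sum, mul_left_comm t] at h3 ⊢
      exact h3
    have h3 : endOf B u (a - a') + (a + a') = 0 := by
      refine w.eq_zero_of_lam fun k => ?_
      have h4 := hm k (a - a')
      simp only [map_sub (w.lam _) a a'] at h4
      have h5 := h2 k
      rw [← h4] at h5
      have hq' : (q : ℂ) ≠ 0 := by exact_mod_cast hq.ne'
      refine mul_left_cancel₀ hq' ?_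
      rw [map_add, map_add]
      linear_combination h5
    have h4 : endOf B u ((1 / 2 : ℂ) • (a - a')) = -((1 / 2 : ℂ) • (a + a')) := by
      rw [map_smul, eq_neg_of_add_eq_zero_left h3, smul_neg]
    -- From `a = x - ux` and `a' = -(ux + x)` one recovers `x = (a - a') / 2`.
    refine (mem_gr B u).2 ⟨(1 / 2 : ℂ) • (a - a'), p, hp, r, hr, ?_⟩
    rw [h4]
    congr 3
    · module
    · module

/-- The coefficients which express the matrix entries of the exponential of a pair of elements of
the Cartan subalgebra as combinations of exponentials of weights. -/
def WeightFrame.entryCoeff (w : WeightFrame h) :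
    (Fin N × Fin N) ⊕ (Fin N × Fin N) → Fin N ⊕ Fin N → ℂ :=
  Sum.elim (fun ij => Sum.elim (fun k => w.P.1 ij.1 k * (w.P⁻¹).1 k ij.2) 0)
    (fun ij => Sum.elim 0 (fun k => w.P.1 ij.1 k * (w.P⁻¹).1 k ij.2))

theorem WeightFrame.glProdCoord_expCartan (w : WeightFrame h) (a a' : h) (t : ℂ) :
    glProdCoord (expProd (t • ((a, a') : g × g))) = fun s =>
      ∑ i, w.entryCoeff s i * Complex.exp (t * Sum.elim (w.lam · a) (w.lam · a') i) := by
  have h1 : ∀ (a : h) (i j : Fin N), (expCartan (t • a) : GL (Fin N) ℂ).1 i j =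
      ∑ k, w.P.1 i k * (w.P⁻¹).1 k j * Complex.exp (t * w.lam k a) := by
    intro a i j
    rw [eq_of_conjHom w.P (expCartan (t • a)).1, w.conj_expCartan, Matrix.mul_apply]
    refine Finset.sum_congr rfl fun k _ => ?_
    rw [Matrix.mul_diagonal, map_smul, smul_eq_mul]
    ring
  ext s
  rw [Fintype.sum_sum_type]
  rcases s with ⟨i, j⟩ | ⟨i, j⟩
  · simp only [WeightFrame.entryCoeff, Sum.elim_inl, Sum.elim_inr, Pi.zero_apply, zero_mul,
      Finset.sum_const_zero, add_zero]
    exact h1 a i j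
  · simp only [WeightFrame.entryCoeff, Sum.elim_inl, Sum.elim_inr, Pi.zero_apply, zero_mul,
      Finset.sum_const_zero, zero_add]
    exact h1 a' i j

/-- Root vectors have zero diagonal in the weight basis, and the weights separate points of the
Cartan subalgebra. -/
theorem WeightFrame.eq_of_mem_gr (w : WeightFrame h) {a a' : h}
    (ha : ((a, a') : g × g) ∈ gr b B u) :
    ∃ x, a = x - endOf B u x ∧ a' = -(endOf B u x + x) := by
  obtain ⟨x, p, hp, q, hq, hx⟩ := (mem_gr B u).1 ha
  have h1 : (a : g) = ((x - endOf B u x : h) : g) + p := congrArg Prod.fst hx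
  have h2 : (a' : g) = ((-(endOf B u x + x) : h) : g) + q := congrArg Prod.snd hx
  refine ⟨x, sub_eq_zero.1 (w.eq_zero_of_lam fun k => ?_),
    sub_eq_zero.1 (w.eq_zero_of_lam fun k => ?_)⟩
  · rw [map_sub, ← (w.conj_add_nPos b (x - endOf B u x) hp).2 k, ← h1, w.conj_eq,
      Matrix.diagonal_apply_eq, sub_self]
  · rw [map_sub, ← (w.conj_add_nNeg b (-(endOf B u x + x)) hq).2 k, ← h2, w.conj_eq,
      Matrix.diagonal_apply_eq, sub_self]

theorem IsRatTensor.of_isAlgebraicLie (halg : IsAlgebraicLie G (gr b B u)) :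
    IsRatTensor b B u := by
  obtain ⟨w⟩ := exists_weightFrame b
  obtain ⟨K, -, ⟨I, hI⟩, hK⟩ := halg
  obtain ⟨p, hp⟩ := exists_ratProj
  let φ : ℂ →+ ℂ := (algebraMap ℚ ℂ).toAddMonoidHom.comp p.toAddMonoidHom
  have hφ : ∀ c, φ c = (p c : ℂ) := fun c => eq_ratCast (algebraMap ℚ ℂ) (p c)
  intro i
  set y := endOf B u ((roots h).coroot i) with hy
  let c := b.toCoweightBasis.repr y
  have hyc : y = ∑ j, c j • (roots h).coroot j := by
    rw [← b.toCoweightBasis.sum_repr y]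
    simp only [RootPairing.Base.toCoweightBasis_apply]
    rfl
  -- The rational replica of `y`. Since `λ_k` is integral on coroots, `φ (λ_k y) = λ_k y'`, while
  -- `φ` fixes the values `λ_k` takes on coroots.
  let y' : h := ∑ j, (p (c j) : ℂ) • (roots h).coroot j
  have hint : ∀ k (j : h.root), φ (w.lam k ((roots h).coroot j)) = w.lam k ((roots h).coroot j) := by
    intro k j
    obtain ⟨z, hz⟩ := w.integral k j
    have := hp z
    rw [hz, hφ]
    exact_mod_cast congrArg (fun q : ℚ => (q : ℂ)) this
  have hlam : ∀ k, φ (w.lam k y) = w.lam k y' := by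
    intro k
    rw [hyc]
    simp only [y', map_sum, map_smul, smul_eq_mul]
    refine Finset.sum_congr rfl fun j _ => ?_
    obtain ⟨z, hz⟩ := w.integral k j
    have h1 := ratProj_mul (p := p) (c j) z
    rw [hz, hφ]
    exact_mod_cast congrArg (fun q : ℚ => (q : ℂ)) h1
  -- Twisting the exponents by `φ` turns the one-parameter group of `ϑ(h_i)`, where `h_i` is the
  -- coroot, into that of the pair with `y'` for `y`. It stays in the closed group `K`.
  have hmem : (((((roots h).coroot i - y' : h) : g), ((-(y' + (roots h).coroot i) : h) : g)) : g × g)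
      ∈ gr b B u := by
    refine (hK _).2 fun t => ?_
    have h1 : ∀ t : ℂ, expProd (t • (((((roots h).coroot i - y : h) : g),
        ((-(y + (roots h).coroot i) : h) : g)) : g × g)) ∈ K := by
      refine (hK _).1 ((mem_gr B u).2 ⟨(roots h).coroot i, 0, zero_mem _, 0, zero_mem _, ?_⟩)
      rw [add_zero, add_zero]
    have h2 : ∀ q ∈ K, q ∈ (K : Set (GL (Fin N) ℂ × GL (Fin N) ℂ)) := fun q hq => hq
    rw [hI] at h2
    rw [← SetLike.mem_coe, hI]
    intro P hP
    rw [w.glProdCoord_expCartan]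
    have h3 := eval_exp_replica w.entryCoeff (Sum.elim (w.lam · ((roots h).coroot i - y))
      (w.lam · (-(y + (roots h).coroot i)))) φ P (fun t => by
        rw [← w.glProdCoord_expCartan]
        exact h2 _ (h1 t) P hP) t
    rw [← h3]
    congr 2
    ext s
    refine Finset.sum_congr rfl fun k _ => ?_
    rcases k with k | k
    · simp only [Sum.elim_inl, map_sub, hlam, hint]
    · simp only [Sum.elim_inr, map_neg, map_add, hlam, hint]
  obtain ⟨x, hx, hx'⟩ := w.eq_of_mem_gr hmem
  -- The difference of the two components is `2x`, and `y'` cancels from it; hence `x` is the coroot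
  -- and `y = y'`.
  have h1 : (roots h).coroot i = x := by
    have h2 : (2 : ℂ) • (roots h).coroot i = (2 : ℂ) • x := by
      rw [two_smul, two_smul]
      have h3 : (roots h).coroot i + (roots h).coroot i =
        ((roots h).coroot i - y') - -(y' + (roots h).coroot i) := by abel
      rw [h3, hx, hx']
      abel
    exact smul_right_injective _ (two_ne_zero' ℂ) h2
  rw [← h1] at hx
  exact ⟨fun j => p (c j), (sub_right_injective hx).symm⟩

end Algebraic

end MultiParam

end

theorem theorem1p8 {N : ℕ} (G : Subgroup (GL (Fin N) ℂ))
    (hGclosed : MultiParam.IsZariskiClosed MultiParam.glCoord (G : Set (GL (Fin N) ℂ)))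
    (hGconn : IsConnected (G : Set (GL (Fin N) ℂ)))
    (g : LieSubalgebra ℂ (Matrix (Fin N) (Fin N) ℂ)) (hg : MultiParam.IsLieAlgebraOf g G)
    [LieAlgebra.HasTrivialRadical ℂ g]
    (h : LieSubalgebra ℂ g) [h.IsCartanSubalgebra]
    (b : (MultiParam.roots h).Base) (d : b.support → ℕ)
    (B : LinearMap.BilinForm ℂ g) (hB : MultiParam.IsNormalizedForm b d B)
    (u : h ⊗[ℂ] h) (hu : TensorProduct.comm ℂ h h u = -u) :
    MultiParam.Gam B u =
        MultiParam.diagSubgroup G ⊓ MultiParam.analyticSubgroup (MultiParam.gr b B u) ∧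
      List.TFAE
        [MultiParam.IsAlgebraicLie G (MultiParam.gr b B u),
          ∀ lam ∈ MultiParam.weightLattice h, ∀ mu ∈ MultiParam.weightLattice h,
            ∃ q : ℚ, MultiParam.formOf u lam mu = q,
          ∃ m : ℕ, 0 < m ∧ ∀ lam ∈ MultiParam.weightLattice h,
            MultiParam.Phi B u (m • lam) ∈ MultiParam.weightLattice h,
          (MultiParam.Gam B u : Set (GL (Fin N) ℂ × GL (Fin N) ℂ)).Finite] := by
  refine ⟨MultiParam.Gam_eq B u b hg, ?_⟩
  have h2 := hB.isRatTensor_iff_formOf u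
  have h3 := MultiParam.isRatTensor_iff_Phi (b := b) (B := B) (u := u)
  tfae_have 1 → 2 := fun halg => h2.1 (.of_isAlgebraicLie halg)
  tfae_have 2 → 1 := fun hrat => (h2.2 hrat).isAlgebraicLie hGclosed hg
  tfae_have 2 ↔ 3 := h2.symm.trans h3
  tfae_have 2 → 4 := fun hrat => (h2.2 hrat).finite
  tfae_have 4 → 2 := fun hfin => h2.1 (.of_finite b hfin)
  tfae_finish
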